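/- Let $\Omega\subset\mathbb R^3$ be a bounded Lipschitz domain, $T>0$, $\varepsilon>0$. Let $F\in C^{1,1}[f_1,f_2]$ have two local minimizers $y_1,y_2$ with $-\infty<f_1<y_1<y_2<f_2<\infty$, and let $F'$ be extended outside $[f_1,f_2]$ by any function that is $\le 0$ on $(-\infty,f_1)$ and $\ge 0$ on $(f_2,\infty)$. Let $c_0\in L^2(\Omega)$ satisfy $f_1\le c_0\le f_2$ a.e. in $\Omega$. For $s\in\{1,2\}$ let $W^{s,2}_n(\Omega)$ be the closure in $W^{s,2}(\Omega)$ of the functions $\phi\in C^\infty(\overline\Omega)$ with $\nabla\phi\cdot\mathbf n=0$ on $\partial\Omega$, let $L^2_{\mathrm{div}}(\Omega)$ be the closure in $L^2(\Omega)^3$ of the divergence-free fields in $C_0^\infty(\Omega)^3$, and let $W^{1,2}_{0,\mathrm{div}}(\Omega)=W^{1,2}_0(\Omega)^3\cap L^2_{\mathrm{div}}(\Omega)$. For $\mathbf u\in L^2(0,T;W^{1,2}_{0,\mathrm{div}}(\Omega))$, a function $c\in L^\infty(0,T;W^{1,2}_n(\Omega))\cap L^2(0,T;W^{2,2}_n(\Omega))$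 is called a solution with velocity $\mathbf u$ emanating from $c_0$ if it has a weak time derivative $c_t\in L^1((0,T)\times\Omega)$, attains the initial value $c_0$, that is, $$\int_0^T\!\!\int_\Omega c\,\partial_t\psi\,dx\,dt=-\int_\Omega c_0\,\psi(0,\cdot)\,dx-\int_0^T\!\!\int_\Omega c_t\,\psi\,dx\,dt\qquad\text{for all }\psi\in C_0^\infty((-\infty,T)\times\Omega),$$ and satisfies $$c_t+\mathbf u\cdot\nabla c=\varepsilon\Delta c-\tfrac1\varepsilon F'(c)\qquad\text{a.e. in }(0,T)\times\Omega .$$ (1) There is a constant $K$ such that for all $\mathbf u_1,\mathbf u_2\in L^2(0,T;W^{1,2}_{0,\mathrm{div}}(\Omega))$ and all solutions $c_1,c_2$ with velocities $\mathbf u_1,\mathbf u_2$, respectively, both emanating from $c_0$, $$\int_\Omega |c_1-c_2|^2(t)\,dx\le K\int_0^t\!\!\int_\Omega\left(|\nabla(c_1-c_2)|^2+|\mathbf u_1-\mathbf u_2|^2\right)dx\,ds\qquad\text{for a.e. }t\in[0,T].$$ (2) Consequently, if $c$ and $C$ are solutions with velocities $\mathbf u$ and $\mathbf U$ in $L^2(0,T;W^{1,2}_{0,\mathrm{div}}(\Omega))$,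 respectively, both emanating from $c_0$, and the relative entropy $$\mathcal E(\mathbf u,c\,|\,\mathbf U,C)(t)=\int_\Omega\left(\tfrac12|\mathbf u-\mathbf U|^2+\tfrac\varepsilon2|\nabla(c-C)|^2\right)(t)\,dx$$ vanishes for a.e. $t\in[0,T]$, then $c=C$ a.e. in $(0,T)\times\Omega$. -/

import Mathlib

open MeasureTheory Set Filter Topology Metric
open scoped NNReal ENNReal ContDiff

noncomputable section

namespace AllenCahn

/-- Physical space `ℝ³` with the Euclidean norm. -/
abbrev E3 := EuclideanSpace ℝ (Fin 3)

/-! ### Lipschitz domains and their normals -/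

/-- A bounded Lipschitz domain: a bounded nonempty connected open set which near each of its boundary
points is, in suitable Cartesian coordinates with vertical direction `e`, the set of points lying
above the graph of a Lipschitz function `γ` of the horizontal part `x - ⟪e, x⟫ e` of `x`. -/
structure IsLipschitzDomain (Ω : Set E3) : Prop where
  isOpen : IsOpen Ω
  isConnected : IsConnected Ω
  isBounded : Bornology.IsBounded Ω
  graph : ∀ p ∈ frontier Ω, ∃ (e : E3) (γ : E3 → ℝ) (L : ℝ≥0) (r : ℝ),
    ‖e‖ = 1 ∧ LipschitzWith L γ ∧ 0 < r ∧
      ∀ x ∈ ball p r, (x ∈ Ω ↔ γ (x - (inner ℝ e x) • e) < inner ℝ e x)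

/-- `ν` is the outer unit normal of `Ω` at `p`: to first order at `p`, the set `Ω` is the half space
`{x | ⟪ν, x - p⟫ < 0}`. For the region above a Lipschitz graph such a `ν` exists exactly at
the points over which the graph function is differentiable, hence at almost every boundary point. -/
def IsOuterNormal (Ω : Set E3) (p ν : E3) : Prop :=
  ‖ν‖ = 1 ∧ ∀ δ : ℝ, 0 < δ → ∀ᶠ x in 𝓝 p,
    (inner ℝ ν (x - p) < -(δ * ‖x - p‖) → x ∈ Ω) ∧
    (δ * ‖x - p‖ < inner ℝ ν (x - p) → x ∉ Ω)

/-- The classical homogeneous Neumann condition `∇φ · n = 0` on `∂Ω`. -/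
def NeumannZero (Ω : Set E3) (φ : E3 → ℝ) : Prop :=
  ∀ p ∈ frontier Ω, ∀ ν : E3, IsOuterNormal Ω p ν → inner ℝ (gradient φ p) ν = 0

/-! ### Function spaces

A Sobolev function is recorded together with its weak derivatives (which it determines): elements of
the spaces below are tuples `(f, ∇f)` or `(f, ∇f, D²f)` of classes in `L²(Ω)`. The norm of the
product of the `L²` spaces is equivalent to the usual Sobolev norm. -/

/-- `L²(Ω; V)`. -/
abbrev L2 (Ω : Set E3) (V : Type) [NormedAddCommGroup V] := Lp V 2 (volume.restrict Ω)

/-- Pairs `(f, ∇f)` for a scalar `f`. -/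
abbrev Jet1 (Ω : Set E3) := L2 Ω ℝ × L2 Ω E3

/-- Triples `(f, ∇f, D²f)` for a scalar `f`. -/
abbrev Jet2 (Ω : Set E3) := L2 Ω ℝ × L2 Ω E3 × L2 Ω (E3 →L[ℝ] E3)

/-- Pairs `(v, ∇v)` for a vector field `v`. -/
abbrev VJet1 (Ω : Set E3) := L2 Ω E3 × L2 Ω (E3 →L[ℝ] E3)

/-- `W^{1,2}_n(Ω)`: the closure in the `W^{1,2}` norm of the functions smooth up to the boundary
with `∇φ · n = 0` on `∂Ω`. -/
def W12n (Ω : Set E3) : Set (Jet1 Ω) :=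
  closure {J | ∃ φ : E3 → ℝ, ContDiff ℝ ∞ φ ∧ NeumannZero Ω φ ∧
    J.1 =ᵐ[volume.restrict Ω] φ ∧ J.2 =ᵐ[volume.restrict Ω] gradient φ}

/-- `W^{2,2}_n(Ω)`: the closure in the `W^{2,2}` norm of the functions smooth up to the boundary
with `∇φ · n = 0` on `∂Ω`. -/
def W22n (Ω : Set E3) : Set (Jet2 Ω) :=
  closure {J | ∃ φ : E3 → ℝ, ContDiff ℝ ∞ φ ∧ NeumannZero Ω φ ∧
    J.1 =ᵐ[volume.restrict Ω] φ ∧ J.2.1 =ᵐ[volume.restrict Ω] gradient φ ∧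
    J.2.2 =ᵐ[volume.restrict Ω] fderiv ℝ (gradient φ)}

/-- The trace of a linear map of `ℝ³`: applied to `D v` it is `div v`, to `D² f` it is `Δ f`. -/
def tr (A : E3 →L[ℝ] E3) : ℝ := ∑ i : Fin 3, (A (EuclideanSpace.single i 1)) i

/-- Smooth vector fields with compact support in `Ω`. -/
def IsTestField (Ω : Set E3) (φ : E3 → E3) : Prop :=
  ContDiff ℝ ∞ φ ∧ HasCompactSupport φ ∧ tsupport φ ⊆ Ω

/-- `L²_div(Ω)`: the `L²` closure of the solenoidal test fields. -/
def L2div (Ω : Set E3) : Set (L2 Ω E3) :=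
  closure {v | ∃ φ : E3 → E3, IsTestField Ω φ ∧ (∀ x, tr (fderiv ℝ φ x) = 0) ∧
    v =ᵐ[volume.restrict Ω] φ}

/-- `W^{1,2}_0(Ω; ℝ³)`: the `W^{1,2}` closure of the test fields. -/
def W120 (Ω : Set E3) : Set (VJet1 Ω) :=
  closure {J | ∃ φ : E3 → E3, IsTestField Ω φ ∧
    J.1 =ᵐ[volume.restrict Ω] φ ∧ J.2 =ᵐ[volume.restrict Ω] fderiv ℝ φ}

/-- `W^{1,2}_{0,div}(Ω) = W^{1,2}_0(Ω) ∩ L²_div(Ω)`. -/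
def W120div (Ω : Set E3) : Set (VJet1 Ω) := {J | J ∈ W120 Ω ∧ J.1 ∈ L2div Ω}

/-! ### The potential -/

/-- `F ∈ C^{1,1}[f₁, f₂]` with two local minimizers `f₁ < y₁ < y₂ < f₂`. -/
structure IsDoubleWell (F : ℝ → ℝ) (f₁ y₁ y₂ f₂ : ℝ) : Prop where
  lt₁ : f₁ < y₁
  lt₂ : y₁ < y₂
  lt₃ : y₂ < f₂
  differentiableOn : DifferentiableOn ℝ F (Icc f₁ f₂)
  lipschitz_deriv : ∃ L : ℝ≥0, LipschitzOnWith L (derivWithin F (Icc f₁ f₂)) (Icc f₁ f₂)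
  isLocalMin₁ : IsLocalMin F y₁
  isLocalMin₂ : IsLocalMin F y₂

/-- `dF` is `F'` on `[f₁, f₂]`. The potential is given on `[f₁, f₂]` only; outside this interval
`dF` may be any function having the sign of the slope of a double well, i.e. `F` is thought of as
extended to be nonincreasing to the left of `f₁` and nondecreasing to the right of `f₂`.
So no bound on the concentration is built into the equation. -/
structure IsPotentialDeriv (F : ℝ → ℝ) (f₁ f₂ : ℝ) (dF : ℝ → ℝ) : Prop where
  eq_deriv : ∀ s ∈ Icc f₁ f₂, dF s = derivWithin F (Icc f₁ f₂) s
  nonpos : ∀ s, s < f₁ → dF s ≤ 0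
  nonneg : ∀ s, f₂ < s → 0 ≤ dF s

/-! ### The convective Allen–Cahn equation -/

/-- `u ∈ L²(0, T; W^{1,2}_{0,div}(Ω))`. -/
def IsVelocity (Ω : Set E3) (T : ℝ) (u : ℝ → VJet1 Ω) : Prop :=
  MemLp u 2 (volume.restrict (Ioo 0 T)) ∧
  ∀ᵐ t ∂(volume.restrict (Ioo 0 T)), u t ∈ W120div Ω

/-- `c ∈ L^∞(0, T; W^{1,2}_n(Ω)) ∩ L²(0, T; W^{2,2}_n(Ω))`. -/
structure IsConcentration (Ω : Set E3) (T : ℝ) (c : ℝ → Jet2 Ω) : Prop where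
  memLp_top : MemLp (fun t => (((c t).1, (c t).2.1) : Jet1 Ω)) ⊤ (volume.restrict (Ioo 0 T))
  mem_W12n : ∀ᵐ t ∂(volume.restrict (Ioo 0 T)), (((c t).1, (c t).2.1) : Jet1 Ω) ∈ W12n Ω
  memLp_two : MemLp c 2 (volume.restrict (Ioo 0 T))
  mem_W22n : ∀ᵐ t ∂(volume.restrict (Ioo 0 T)), c t ∈ W22n Ω

/-- `d` is the weak time derivative of `c` on `(0, T) × Ω`, and `c` has the initial value `c₀`: for
all smooth `ψ` with compact support in `(-∞, T) × Ω`,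
`∫₀ᵀ∫ c ∂ₜψ = - ∫ c₀ ψ(0, ·) - ∫₀ᵀ∫ d ψ`.
(The `ψ` supported in `(0, T) × Ω` express that `d = ∂ₜc` in the sense of distributions.) -/
def HasWeakTimeDeriv (Ω : Set E3) (T : ℝ) (c : ℝ → L2 Ω ℝ) (c₀ : L2 Ω ℝ)
    (d : ℝ → Lp ℝ 1 (volume.restrict Ω)) : Prop :=
  ∀ ψ : ℝ × E3 → ℝ, ContDiff ℝ ∞ ψ → HasCompactSupport ψ → tsupport ψ ⊆ Iio T ×ˢ Ω →
    ∫ t in Ioo 0 T, ∫ x in Ω, c t x * deriv (fun s => ψ (s, x)) t =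
      -(∫ x in Ω, c₀ x * ψ (0, x)) - ∫ t in Ioo 0 T, ∫ x in Ω, d t x * ψ (t, x)

/-- `c` is a solution of `c_t + u · ∇c = ε Δc - (1/ε) F'(c)` emanating from `c₀`: it has a weak time
derivative `d`, an integrable function on `(0, T) × Ω`, and the equation holds almost everywhere. -/
def IsSolution (Ω : Set E3) (T ε : ℝ) (dF : ℝ → ℝ) (c₀ : L2 Ω ℝ)
    (u : ℝ → VJet1 Ω) (c : ℝ → Jet2 Ω) : Prop :=
  ∃ d : ℝ → Lp ℝ 1 (volume.restrict Ω),
    Integrable d (volume.restrict (Ioo 0 T)) ∧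
    HasWeakTimeDeriv Ω T (fun t => (c t).1) c₀ d ∧
    ∀ᵐ t ∂(volume.restrict (Ioo 0 T)), ∀ᵐ x ∂(volume.restrict Ω),
      d t x + inner ℝ ((u t).1 x) ((c t).2.1 x) =
        ε * tr ((c t).2.2 x) - (1 / ε) * dF ((c t).1 x)

/-- The relative entropy `∫_Ω ½ |u - U|² + (ε/2) |∇(c - C)|²` at one instant of time. -/
def relativeEntropy (Ω : Set E3) (ε : ℝ) (u : VJet1 Ω) (c : Jet2 Ω) (U : VJet1 Ω) (C : Jet2 Ω) : ℝ :=
  ∫ x in Ω, ((1 / 2) * ‖u.1 x - U.1 x‖ ^ 2 + (ε / 2) * ‖c.2.1 x - C.2.1 x‖ ^ 2)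

end AllenCahn

end

noncomputable section

namespace AllenCahn

/-! ### The divergence theorem for fields tangential to the boundary -/

/-! The stability estimate is an `L²` energy estimate for `w = c₁ - c₂`, closed by Grönwall. Three
facts carry it.

Boundary terms. `W22n` and `L2div` are closures of smooth classes, so Green's formula and the
vanishing of transport integrals are proved for smooth functions and passed to the limit. The smooth
case needs only that the divergence of a field tangential to the boundary has integral zero on a
Lipschitz domain. No surface measure enters: the field is multiplied by a Lipschitz cut-off of the
height above the graph, and tangency cancels the factor `1/δ` in the cut-off's gradient
(`IsGraphChart.integral_tr_fderiv_eq_zero`).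

Time regularity. The time derivative is only in `L¹`, so a solution is identified with an absolutely
continuous curve `c₀ + ∫₀ᵗ d` in `L¹(Ω)` (`HasWeakTimeDeriv.ae_eq_primitive`). For `B` with bounded
continuous derivative `β`, the chain rule for `∫ B(w)` holds along such curves
(`integral_comp_primitive_le`).

A priori bound. Testing with a bounded monotone function that vanishes exactly on `[f₁, f₂]` shows
that solutions keep their values there: diffusion and reaction have the right sign and transport
contributes nothing (`IsSolution.mem_Icc`). Hence `F'` acts as a Lipschitz function, and `s²` may be
replaced by a truncation.

In the equation for `w`, the reaction costs a multiple of `∫ w²`. The convective difference is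
rearranged into exact transport terms, which integrate to zero, plus `2 c₂ (u₁ - u₂) · ∇w`, which
the bound on `c₂` controls by `|∇w|² + |u₁ - u₂|²` (`two_mul_sub_mul_le`). If the relative entropy
vanishes, so does the right side of the estimate. -/

theorem tr_add (A B : E3 →L[ℝ] E3) : tr (A + B) = tr A + tr B := by
  simp [tr, Finset.sum_add_distrib]

theorem tr_smul (a : ℝ) (A : E3 →L[ℝ] E3) : tr (a • A) = a * tr A := by
  simp [tr, Finset.mul_sum]

/-- The trace as a continuous linear functional. -/
def trL : (E3 →L[ℝ] E3) →L[ℝ] ℝ :=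
  LinearMap.toContinuousLinearMap ⟨⟨tr, tr_add⟩, tr_smul⟩

@[simp] theorem trL_apply (A : E3 →L[ℝ] E3) : trL A = tr A := rfl

theorem apply_eq_sum_single (l : E3 →L[ℝ] ℝ) (y : E3) :
    l y = ∑ i : Fin 3, l (EuclideanSpace.single i 1) * y i := by
  have h : y = ∑ i : Fin 3, y i • EuclideanSpace.single i (1 : ℝ) := by
    simpa using ((EuclideanSpace.basisFun (Fin 3) ℝ).sum_repr y).symm
  conv_lhs => rw [h]
  simp [mul_comm]

theorem tr_smulRight (l : E3 →L[ℝ] ℝ) (y : E3) : tr (l.smulRight y) = l y := by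
  rw [apply_eq_sum_single l y]
  simp [tr]

theorem tr_fderiv_smul {f : E3 → ℝ} {X : E3 → E3} {x : E3} (hf : DifferentiableAt ℝ f x)
    (hX : DifferentiableAt ℝ X x) :
    tr (fderiv ℝ (fun x => f x • X x) x) = fderiv ℝ f x (X x) + f x * tr (fderiv ℝ X x) := by
  rw [fderiv_fun_smul hf hX, tr_add, tr_smul, tr_smulRight, add_comm]

theorem continuous_tr_fderiv {Y : E3 → E3} (hY : ContDiff ℝ 1 Y) :
    Continuous fun x => tr (fderiv ℝ Y x) :=
  trL.continuous.comp (hY.continuous_fderiv one_ne_zero)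

theorem hasCompactSupport_tr_fderiv {Y : E3 → E3} (hc : HasCompactSupport Y) :
    HasCompactSupport fun x => tr (fderiv ℝ Y x) :=
  (hc.fderiv ℝ).comp_left (g := tr) (by simp [tr])

/-- Integration by parts for a Lipschitz function against a compactly supported vector field. -/
theorem integral_mul_tr_fderiv {K : ℝ≥0} {f : E3 → ℝ} (hf : LipschitzWith K f) {Y : E3 → E3}
    (hY : ContDiff ℝ 1 Y) (hc : HasCompactSupport Y) :
    ∫ x, f x * tr (fderiv ℝ Y x) = -∫ x, fderiv ℝ f x (Y x) := by
  have hYi : ∀ i, ContDiff ℝ 1 fun x => Y x i := fun i =>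
    (EuclideanSpace.proj i : E3 →L[ℝ] ℝ).contDiff.comp hY
  have hci : ∀ i, HasCompactSupport fun x => Y x i := fun i =>
    hc.comp_left (g := fun y : E3 => y i) rfl
  have hd : ∀ i x, fderiv ℝ (fun x => Y x i) x (EuclideanSpace.single i 1)
      = (fderiv ℝ Y x (EuclideanSpace.single i 1)) i := by
    intro i x
    have := ((EuclideanSpace.proj i : E3 →L[ℝ] ℝ).hasFDerivAt.comp x
      (hY.differentiable one_ne_zero x).hasFDerivAt).fderiv
    exact congrArg (fun l => l (EuclideanSpace.single i 1)) this
  have hI1 : ∀ i ∈ (Finset.univ : Finset (Fin 3)),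
      Integrable fun x => f x * (fderiv ℝ Y x (EuclideanSpace.single i 1)) i := by
    intro i _
    simp_rw [← hd i]
    exact (hf.continuous.mul (((hYi i).continuous_fderiv one_ne_zero).clm_apply
      continuous_const)).integrable_of_hasCompactSupport
      (((hci i).fderiv_apply ℝ _).mul_left)
  have hI2 : ∀ i ∈ (Finset.univ : Finset (Fin 3)), Integrable fun x =>
      lineDeriv ℝ f x (EuclideanSpace.single i 1) * Y x i := by
    intro i _
    exact ((hYi i).continuous.integrable_of_hasCompactSupport (hci i)).bdd_mul
      (hf.memLp_lineDeriv _ (μ := volume)).1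
      (Eventually.of_forall fun x => norm_lineDeriv_le_of_lipschitz ℝ hf)
  have key : ∀ i, ∫ x, f x * (fderiv ℝ Y x (EuclideanSpace.single i 1)) i
      = -∫ x, lineDeriv ℝ f x (EuclideanSpace.single i 1) * Y x i := by
    intro i
    obtain ⟨D, hD⟩ := (hYi i).lipschitzWith_of_hasCompactSupport (hci i) one_ne_zero
    rw [hf.integral_lineDeriv_mul_eq hD (hci i), ← integral_neg]
    refine integral_congr_ae (Eventually.of_forall fun x => ?_)
    simp only
    rw [((hYi i).differentiable one_ne_zero x).lineDeriv_eq_fderiv, map_neg, hd]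
    ring
  have h1 : ∫ x, f x * tr (fderiv ℝ Y x)
      = ∑ i : Fin 3, ∫ x, f x * (fderiv ℝ Y x (EuclideanSpace.single i 1)) i := by
    rw [← integral_finsetSum _ hI1]
    simp [tr, Finset.mul_sum]
  have h2 : ∫ x, fderiv ℝ f x (Y x)
      = ∑ i : Fin 3, ∫ x, lineDeriv ℝ f x (EuclideanSpace.single i 1) * Y x i := by
    rw [← integral_finsetSum _ hI2]
    refine integral_congr_ae ?_
    filter_upwards [hf.ae_differentiableAt (μ := volume)] with x hx
    simp_rw [hx.lineDeriv_eq_fderiv]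
    exact apply_eq_sum_single _ _
  rw [h1, h2, ← Finset.sum_neg_distrib]
  exact Finset.sum_congr rfl fun i _ => key i

/-- The height of `x` above the graph of `γ` in direction `e`. -/
def height (e : E3) (γ : E3 → ℝ) (x : E3) : ℝ := inner ℝ e x - γ (x - (inner ℝ e x) • e)

theorem height_add_smul {e : E3} (he : ‖e‖ = 1) (γ : E3 → ℝ) (x : E3) (t : ℝ) :
    height e γ (x + t • e) = height e γ x + t := by
  have h : inner ℝ e (x + t • e) = inner ℝ e x + t := by
    rw [inner_add_right, real_inner_smul_right, real_inner_self_eq_norm_sq, he]; ring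
  have h' : x + t • e - (inner ℝ e x + t) • e = x - (inner ℝ e x) • e := by
    rw [add_smul]; abel
  rw [height, h, h', height]; ring

theorem exists_lipschitzWith_height (e : E3) {γ : E3 → ℝ} {L : ℝ≥0} (hγ : LipschitzWith L γ) :
    ∃ K, LipschitzWith K (height e γ) := by
  have h1 : LipschitzWith ‖innerSL ℝ e‖₊ fun x : E3 => inner ℝ e x :=
    (innerSL ℝ e).lipschitz
  have h2 : LipschitzWith ‖ContinuousLinearMap.id ℝ E3 - (innerSL ℝ e).smulRight e‖₊
      fun x : E3 => x - (inner ℝ e x) • e :=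
    (ContinuousLinearMap.id ℝ E3 - (innerSL ℝ e).smulRight e).lipschitz
  exact ⟨_, h1.sub (hγ.comp h2)⟩

/-- The height function is differentiable at a point iff it is at the foot point on the graph. -/
theorem hasFDerivAt_height_foot {e : E3} (he : ‖e‖ = 1) {γ : E3 → ℝ} {x : E3} {l : E3 →L[ℝ] ℝ}
    (h : HasFDerivAt (height e γ) l x) (t : ℝ) : HasFDerivAt (height e γ) l (x - t • e) := by
  have h1 : HasFDerivAt (fun y : E3 => height e γ (y + t • e) - t) l (x - t • e) := by
    refine HasFDerivAt.sub_const t ?_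
    rw [hasFDerivAt_comp_add_right, sub_add_cancel]
    exact h
  refine h1.congr_of_eventuallyEq (Eventually.of_forall fun y => ?_)
  simp [height_add_smul he]

/-- A graph chart of `Ω` in a ball. -/
structure IsGraphChart (Ω : Set E3) (p e : E3) (γ : E3 → ℝ) (r : ℝ) : Prop where
  norm_eq : ‖e‖ = 1
  mem_iff : ∀ x ∈ ball p r, (x ∈ Ω ↔ 0 < height e γ x)

theorem IsGraphChart.mem_frontier {Ω : Set E3} {p e : E3} {γ : E3 → ℝ} {r : ℝ}
    (h : IsGraphChart Ω p e γ r) {q : E3} (hq : q ∈ ball p r) (hq0 : height e γ q = 0) :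
    q ∈ frontier Ω := by
  refine ⟨?_, fun hi => ?_⟩
  · have ht : Tendsto (fun t : ℝ => q + t • e) (𝓝[>] 0) (𝓝 q) := by
      have : Continuous fun t : ℝ => q + t • e := by fun_prop
      simpa using (this.tendsto 0).mono_left nhdsWithin_le_nhds
    refine mem_closure_of_tendsto ht ?_
    filter_upwards [ht (isOpen_ball.mem_nhds hq), self_mem_nhdsWithin] with t h1 h2
    rw [h.mem_iff _ h1, height_add_smul h.norm_eq, hq0, zero_add]
    exact h2
  · have := (h.mem_iff q hq).1 (interior_subset hi)
    exact absurd this (by simp [hq0])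

/-- Near `q` the set is `{height > 0}`, and the first-order expansion of the height, with error at
most `δ‖n‖‖x - q‖`, fixes its sign outside a thin cone around the tangent plane. The height grows
into `Ω`, hence the minus sign. -/
theorem IsGraphChart.isOuterNormal {Ω : Set E3} {p e : E3} {γ : E3 → ℝ} {r : ℝ}
    (h : IsGraphChart Ω p e γ r) {q : E3} (hq : q ∈ ball p r) (hq0 : height e γ q = 0)
    {n : E3} (hn : n ≠ 0) (hd : HasFDerivAt (height e γ) (innerSL ℝ n) q) :
    IsOuterNormal Ω q (-(‖n‖⁻¹ • n)) := by
  have hn' : 0 < ‖n‖ := norm_pos_iff.2 hn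
  refine ⟨by rw [norm_neg, norm_smul, norm_inv, norm_norm, inv_mul_cancel₀ hn'.ne'], ?_⟩
  intro δ hδ
  have := (hasFDerivAt_iff_isLittleO.1 hd).def (mul_pos hδ hn')
  filter_upwards [this, isOpen_ball.mem_nhds hq] with x hx hxb
  rw [hq0, sub_zero, innerSL_apply_apply, Real.norm_eq_abs, abs_le] at hx
  rw [inner_neg_left, real_inner_smul_left, h.mem_iff x hxb]
  have e1 : inner ℝ n (x - q) = ‖n‖ * (‖n‖⁻¹ * inner ℝ n (x - q)) := by
    field_simp
  set m := ‖n‖⁻¹ * inner ℝ n (x - q)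
  constructor
  · intro h1
    have : ‖n‖ * (δ * ‖x - q‖) < ‖n‖ * m := by
      apply mul_lt_mul_of_pos_left _ hn'; linarith
    nlinarith [hx.1]
  · intro h1
    have : ‖n‖ * (δ * ‖x - q‖) < ‖n‖ * (-m) := by
      apply mul_lt_mul_of_pos_left _ hn'; linarith
    nlinarith [hx.2]

/-- The field `Y` is tangential to the boundary wherever `Ω` has an outer normal. -/
def IsTangential (Ω : Set E3) (Y : E3 → E3) : Prop :=
  ∀ p ∈ frontier Ω, ∀ ν : E3, IsOuterNormal Ω p ν → inner ℝ (Y p) ν = 0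

/-- By Riesz the differential is `⟪n, ·⟫`. Either `n = 0`, or `-n/‖n‖` is an outer normal, to which
`Y q` is orthogonal. -/
theorem IsGraphChart.fderiv_height_apply_eq_zero {Ω : Set E3} {p e : E3} {γ : E3 → ℝ} {r : ℝ}
    (h : IsGraphChart Ω p e γ r) {q : E3} (hq : q ∈ ball p r) (hq0 : height e γ q = 0)
    {Y : E3 → E3} (hY : IsTangential Ω Y) {l : E3 →L[ℝ] ℝ}
    (hd : HasFDerivAt (height e γ) l q) : l (Y q) = 0 := by
  obtain ⟨n, rfl⟩ := (InnerProductSpace.toDual ℝ E3).surjective l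
  rcases eq_or_ne n 0 with rfl | hn
  · simp
  have := hY q (h.mem_frontier hq hq0) _ (h.isOuterNormal hq hq0 hn hd)
  rw [inner_neg_right, real_inner_smul_right, neg_eq_zero, mul_eq_zero, inv_eq_zero,
    norm_eq_zero] at this
  rw [InnerProductSpace.toDual_apply_apply, real_inner_comm]
  exact this.resolve_left hn

/-- A Lipschitz cut-off which vanishes below the graph and equals `1` above height `δ`. -/
def cutoff (δ s : ℝ) : ℝ := max 0 (min 1 (δ⁻¹ * s))

theorem lipschitzWith_cutoff (δ : ℝ) : LipschitzWith ‖δ⁻¹‖₊ (cutoff δ) := by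
  have h : LipschitzWith ‖δ⁻¹‖₊ fun s : ℝ => δ⁻¹ * s :=
    (lipschitzWith_smul δ⁻¹ : LipschitzWith _ fun s : ℝ => δ⁻¹ • s)
  exact (h.const_min 1).const_max 0

theorem cutoff_nonneg (δ s : ℝ) : 0 ≤ cutoff δ s := le_max_left _ _

theorem cutoff_le_one (δ s : ℝ) : cutoff δ s ≤ 1 := max_le zero_le_one (min_le_left _ _)

theorem cutoff_of_nonpos {δ s : ℝ} (hδ : 0 < δ) (hs : s ≤ 0) : cutoff δ s = 0 :=
  max_eq_left ((min_le_right _ _).trans (mul_nonpos_of_nonneg_of_nonpos (inv_pos.2 hδ).le hs))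

theorem cutoff_of_le {δ s : ℝ} (hδ : 0 < δ) (hs : δ ≤ s) : cutoff δ s = 1 := by
  have : 1 ≤ δ⁻¹ * s := by rw [inv_mul_eq_div]; exact (one_le_div hδ).2 hs
  rw [cutoff, min_eq_left this, max_eq_right zero_le_one]

theorem cutoff_of_mem {δ s : ℝ} (hδ : 0 < δ) (h0 : 0 ≤ s) (h1 : s ≤ δ) :
    cutoff δ s = δ⁻¹ * s := by
  have : δ⁻¹ * s ≤ 1 := by rw [inv_mul_eq_div]; exact (div_le_one hδ).2 h1
  rw [cutoff, min_eq_right this, max_eq_right (mul_nonneg (inv_pos.2 hδ).le h0)]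

/-- The cut-off attains an extreme value at such points, so Fermat's rule applies even at the kinks,
with no differentiability of `G`. -/
theorem fderiv_cutoff_comp_eq_zero {δ : ℝ} (hδ : 0 < δ) {G : E3 → ℝ} {x : E3}
    (hx : G x ≤ 0 ∨ δ ≤ G x) : fderiv ℝ (fun y => cutoff δ (G y)) x = 0 := by
  rcases hx with hx | hx
  · refine IsLocalMin.fderiv_eq_zero (Eventually.of_forall fun y => ?_)
    simp only [cutoff_of_nonpos hδ hx]
    exact cutoff_nonneg _ _
  · refine IsLocalMax.fderiv_eq_zero (Eventually.of_forall fun y => ?_)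
    simp only [cutoff_of_le hδ hx]
    exact cutoff_le_one _ _

theorem fderiv_cutoff_comp_of_mem {δ : ℝ} (hδ : 0 < δ) {G : E3 → ℝ} {x : E3}
    (hG : DifferentiableAt ℝ G x) (h0 : 0 < G x) (h1 : G x < δ) :
    fderiv ℝ (fun y => cutoff δ (G y)) x = δ⁻¹ • fderiv ℝ G x := by
  have h : (fun y => cutoff δ (G y)) =ᶠ[𝓝 x] fun y => δ⁻¹ * G y := by
    filter_upwards [hG.continuousAt.eventually (lt_mem_nhds h0),
      hG.continuousAt.eventually (gt_mem_nhds h1)] with y h2 h3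
    exact cutoff_of_mem hδ (le_of_lt h2) (le_of_lt h3)
  rw [h.fderiv_eq, fderiv_const_mul hG]

/-- The divergence theorem for a tangential field supported in a graph chart. -/
theorem IsGraphChart.integral_tr_fderiv_eq_zero {Ω : Set E3} {p e : E3} {γ : E3 → ℝ} {r : ℝ}
    (h : IsGraphChart Ω p e γ r) (hΩ : IsOpen Ω) {L : ℝ≥0} (hγ : LipschitzWith L γ)
    {Y : E3 → E3} (hY : ContDiff ℝ 1 Y) (hc : HasCompactSupport Y) (hs : tsupport Y ⊆ ball p r)
    (ht : IsTangential Ω Y) : ∫ x in Ω, tr (fderiv ℝ Y x) = 0 := by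
  obtain ⟨K, hK⟩ := exists_lipschitzWith_height e hγ
  obtain ⟨D, hD⟩ := hY.lipschitzWith_of_hasCompactSupport hc one_ne_zero
  obtain ⟨r', hr', hs'⟩ := exists_lt_subset_ball (isClosed_tsupport Y) hs
  -- The support of `Y` lies in the smaller ball of radius `r'`. Layers no thicker than `r - r'`
  -- keep the foot points on the graph inside the chart.
  set δ : ℕ → ℝ := fun k => (r - r') * (1 / ((k : ℝ) + 1)) with hδ_def
  have hδ : ∀ k, 0 < δ k := fun k => mul_pos (by linarith) (by positivity)
  have hδr : ∀ k, δ k ≤ r - r' := fun k => by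
    have : 1 / ((k : ℝ) + 1) ≤ 1 := by
      rw [div_le_one (by positivity)]; linarith [Nat.cast_nonneg (α := ℝ) k]
    exact mul_le_of_le_one_right (by linarith) this
  have hδ0 : Tendsto δ atTop (𝓝 0) := by
    simpa [hδ_def] using tendsto_one_div_add_atTop_nhds_zero_nat.const_mul (r - r')
  have hd0 : ∀ x, x ∉ tsupport Y → tr (fderiv ℝ Y x) = 0 := fun x hx => by
    rw [fderiv_of_notMem_tsupport (𝕜 := ℝ) hx]; simp [tr]
  have hdI : Integrable fun x => tr (fderiv ℝ Y x) :=
    (continuous_tr_fderiv hY).integrable_of_hasCompactSupport (hasCompactSupport_tr_fderiv hc)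
  have parts := fun k => integral_mul_tr_fderiv ((lipschitzWith_cutoff (δ k)).comp hK) hY hc
  -- On the support of `Y` the cut-offs converge to the indicator of `Ω`; elsewhere the divergence
  -- is zero.
  have lim1 : Tendsto (fun k => ∫ x, cutoff (δ k) (height e γ x) * tr (fderiv ℝ Y x)) atTop
      (𝓝 (∫ x in Ω, tr (fderiv ℝ Y x))) := by
    rw [← integral_indicator hΩ.measurableSet]
    refine tendsto_integral_of_dominated_convergence (fun x => ‖tr (fderiv ℝ Y x)‖)
      (fun k => ?_) hdI.norm (fun k => Eventually.of_forall fun x => ?_)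
      (Eventually.of_forall fun x => ?_)
    · exact (((lipschitzWith_cutoff (δ k)).comp hK).continuous.mul
        (continuous_tr_fderiv hY)).aestronglyMeasurable
    · rw [norm_mul, Real.norm_of_nonneg (cutoff_nonneg _ _)]
      exact mul_le_of_le_one_left (norm_nonneg _) (cutoff_le_one _ _)
    · by_cases hx : x ∈ tsupport Y
      · by_cases hxΩ : x ∈ Ω
        · rw [indicator_of_mem hxΩ]
          have h0 := (h.mem_iff x (hs hx)).1 hxΩ
          refine tendsto_const_nhds.congr' ?_
          filter_upwards [hδ0.eventually (gt_mem_nhds h0)] with k hk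
          rw [cutoff_of_le (hδ k) hk.le, one_mul]
        · rw [indicator_of_notMem hxΩ]
          have h0 : height e γ x ≤ 0 := not_lt.1 fun h0 => hxΩ ((h.mem_iff x (hs hx)).2 h0)
          simp [cutoff_of_nonpos (hδ _) h0]
      · simp [hd0 x hx, indicator]
  have lim2 : Tendsto (fun k => ∫ x, fderiv ℝ (fun y => cutoff (δ k) (height e γ y)) x (Y x))
      atTop (𝓝 (∫ _ : E3, (0 : ℝ))) := by
    refine tendsto_integral_of_dominated_convergence
      ((tsupport Y).indicator fun _ => (K : ℝ) * D) (fun k => ?_) ?_ (fun k => ?_) ?_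
    · exact (ContinuousLinearMap.id ℝ (E3 →L[ℝ] ℝ)).aestronglyMeasurable_comp₂
        (measurable_fderiv ℝ _).stronglyMeasurable.aestronglyMeasurable
        hY.continuous.aestronglyMeasurable
    · exact (integrable_indicator_iff (isClosed_tsupport Y).measurableSet).2
        (integrableOn_const hc.measure_lt_top.ne)
    · filter_upwards [hK.ae_differentiableAt (μ := volume)] with x hx
      by_cases hxs : x ∈ tsupport Y
      swap
      · rw [image_eq_zero_of_notMem_tsupport hxs, map_zero, norm_zero]
        exact indicator_nonneg (fun _ _ => by positivity) _
      rw [indicator_of_mem hxs]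
      by_cases hcase : height e γ x ≤ 0 ∨ δ k ≤ height e γ x
      · rw [fderiv_cutoff_comp_eq_zero (hδ k) hcase]
        simp; positivity
      push Not at hcase
      rw [fderiv_cutoff_comp_of_mem (hδ k) hx hcase.1 hcase.2]
      -- The foot point of `x` on the graph. The height has the same differential at `x` and at `q`,
      -- and it annihilates `Y q`. So only `Y x - Y q` counts, which is `O(δ)` and compensates
      -- `δ⁻¹`; the bound `K * D` is uniform in `k`.
      set q := x - height e γ x • e
      have hqx : ‖x - q‖ = height e γ x := by
        simp [q, norm_smul, h.norm_eq, abs_of_pos hcase.1]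
      have hq : q ∈ ball p r := by
        have h1 : dist x p < r' := hs' hxs
        have h2 : dist q p ≤ dist q x + dist x p := dist_triangle _ _ _
        rw [dist_comm q x, dist_eq_norm x q, hqx] at h2
        rw [mem_ball]; linarith [hδr k]
      have hq0 : height e γ q = 0 := by
        have := height_add_smul h.norm_eq γ x (-height e γ x)
        rw [neg_smul, ← sub_eq_add_neg] at this
        simpa [q] using this
      have hz := h.fderiv_height_apply_eq_zero hq hq0 ht
        (hasFDerivAt_height_foot h.norm_eq hx.hasFDerivAt _)
      have e1 : fderiv ℝ (height e γ) x (Y x) = fderiv ℝ (height e γ) x (Y x - Y q) := by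
        rw [map_sub, hz, sub_zero]
      rw [_root_.smul_apply, norm_smul, e1, norm_inv,
        Real.norm_of_nonneg (hδ k).le, inv_mul_le_iff₀ (hδ k)]
      calc ‖fderiv ℝ (height e γ) x (Y x - Y q)‖
          ≤ ‖fderiv ℝ (height e γ) x‖ * ‖Y x - Y q‖ := ContinuousLinearMap.le_opNorm _ _
        _ ≤ K * (D * ‖x - q‖) := by
          gcongr
          · exact norm_fderiv_le_of_lipschitz ℝ hK
          · exact hD.norm_sub_le _ _
        _ ≤ δ k * (K * D) := by
          rw [hqx]
          have : (K : ℝ) * D * height e γ x ≤ K * D * δ k :=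
            mul_le_mul_of_nonneg_left hcase.2.le (by positivity)
          linarith
    -- Each point leaves the shrinking layers `0 < height < δ k` eventually, so the integrands tend
    -- to zero everywhere.
    · refine Eventually.of_forall fun x => ?_
      refine tendsto_const_nhds.congr' ?_
      rcases le_or_gt (height e γ x) 0 with h0 | h0
      · refine Eventually.of_forall fun k => ?_
        simp only [fderiv_cutoff_comp_eq_zero (hδ k) (.inl h0)]; simp
      · filter_upwards [hδ0.eventually (gt_mem_nhds h0)] with k hk
        simp only [fderiv_cutoff_comp_eq_zero (hδ k) (.inr hk.le)]; simp
  have e2 : (fun k => ∫ x, cutoff (δ k) (height e γ x) * tr (fderiv ℝ Y x)) =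
      fun k => -∫ x, fderiv ℝ (fun y => cutoff (δ k) (height e γ y)) x (Y x) := funext parts
  rw [e2] at lim1
  simpa using tendsto_nhds_unique lim1 lim2.neg

theorem integral_tr_fderiv_eq_zero_of_tsupport_subset {Ω : Set E3} {Y : E3 → E3}
    (hY : ContDiff ℝ 1 Y) (hc : HasCompactSupport Y) (hs : tsupport Y ⊆ Ω) :
    ∫ x in Ω, tr (fderiv ℝ Y x) = 0 := by
  rw [setIntegral_eq_integral_of_forall_compl_eq_zero]
  · have := integral_mul_tr_fderiv (LipschitzWith.const (1 : ℝ)) hY hc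
    simpa using this
  · intro x hx
    rw [fderiv_of_notMem_tsupport (𝕜 := ℝ) fun h => hx (hs h)]; simp [tr]

theorem IsTangential.smul {Ω : Set E3} {Y : E3 → E3} (h : IsTangential Ω Y) (f : E3 → ℝ) :
    IsTangential Ω fun x => f x • Y x := fun p hp ν hν => by
  rw [real_inner_smul_left, h p hp ν hν, mul_zero]

open scoped Manifold in
/-- The divergence theorem on a bounded Lipschitz domain for tangential fields. -/
theorem IsLipschitzDomain.integral_tr_fderiv_eq_zero {Ω : Set E3} (hΩ : IsLipschitzDomain Ω)
    {Y : E3 → E3} (hY : ContDiff ℝ 1 Y) (ht : IsTangential Ω Y) :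
    ∫ x in Ω, tr (fderiv ℝ Y x) = 0 := by
  -- Inside `Ω` a compactly supported field has no boundary contribution; at a boundary point the
  -- graph chart applies. A partition of unity on the compact closure joins the two cases, since
  -- multiplication by a scalar preserves tangency.
  have hloc : ∀ p ∈ closure Ω, ∃ r : ℝ, 0 < r ∧ ∀ Z : E3 → E3, ContDiff ℝ 1 Z →
      HasCompactSupport Z → IsTangential Ω Z → tsupport Z ⊆ ball p r →
      ∫ x in Ω, tr (fderiv ℝ Z x) = 0 := by
    intro p hp
    by_cases hpΩ : p ∈ Ω
    · obtain ⟨r, hr, hrΩ⟩ := Metric.isOpen_iff.1 hΩ.isOpen p hpΩ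
      exact ⟨r, hr, fun Z hZ hZc _ hZs =>
        integral_tr_fderiv_eq_zero_of_tsupport_subset hZ hZc (hZs.trans hrΩ)⟩
    · obtain ⟨e, γ, L, r, he, hγ, hr, hg⟩ := hΩ.graph p ⟨hp, by rwa [hΩ.isOpen.interior_eq]⟩
      have hch : IsGraphChart Ω p e γ r :=
        ⟨he, fun x hx => by rw [hg x hx, height, sub_pos]⟩
      exact ⟨r, hr, fun Z hZ hZc hZt hZs =>
        hch.integral_tr_fderiv_eq_zero hΩ.isOpen hγ hZ hZc hZs hZt⟩
  choose! r hr0 hr using hloc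
  have hK : IsCompact (closure Ω) := hΩ.isBounded.isCompact_closure
  obtain ⟨S, hS, hcov⟩ := hK.elim_nhds_subcover (fun p => ball p (r p))
    fun p hp => ball_mem_nhds p (hr0 p hp)
  obtain ⟨ρ, hρ⟩ := SmoothPartitionOfUnity.exists_isSubordinate 𝓘(ℝ, E3) isClosed_closure
    (fun p : S => ball (p : E3) (r p)) (fun _ => isOpen_ball)
    (fun x hx => by
      obtain ⟨p, hp, hxp⟩ := mem_iUnion₂.1 (hcov hx)
      exact mem_iUnion.2 ⟨⟨p, hp⟩, hxp⟩)
  have hρs : ∀ p : S, ContDiff ℝ 1 (ρ p) := fun p =>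
    (ρ p).contMDiff.contDiff.of_le (by exact_mod_cast le_top)
  have hsm : ∀ p : S, ContDiff ℝ 1 fun x => ρ p x • Y x := fun p => (hρs p).smul hY
  have hts : ∀ p : S, tsupport (fun x => ρ p x • Y x) ⊆ ball (p : E3) (r p) := fun p =>
    (tsupport_smul_subset_left _ _).trans (hρ p)
  have hcs : ∀ p : S, HasCompactSupport fun x => ρ p x • Y x := fun p =>
    HasCompactSupport.intro' (isCompact_closedBall (p : E3) (r p)) isClosed_closedBall
      fun x hx => image_eq_zero_of_notMem_tsupport (f := fun x => ρ p x • Y x)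
        fun h => hx (ball_subset_closedBall (hts p h))
  have hzero : ∀ p : S, ∫ x in Ω, tr (fderiv ℝ (fun x => ρ p x • Y x) x) = 0 := fun p =>
    hr p (hS p p.2) _ (hsm p) (hcs p) (ht.smul _) (hts p)
  have hsum : ∀ x ∈ Ω, tr (fderiv ℝ Y x)
      = ∑ p : S, tr (fderiv ℝ (fun x => ρ p x • Y x) x) := by
    intro x hx
    have h1 : (fun x => ∑ p : S, ρ p x • Y x) =ᶠ[𝓝 x] Y := by
      filter_upwards [hΩ.isOpen.mem_nhds hx] with y hy
      rw [← Finset.sum_smul]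
      have := ρ.sum_eq_one (subset_closure hy)
      rw [finsum_eq_sum_of_fintype] at this
      rw [this, one_smul]
    rw [← h1.fderiv_eq, fderiv_fun_sum fun p _ => (hsm p).differentiable one_ne_zero x]
    exact map_sum trL _ _
  rw [setIntegral_congr_fun hΩ.isOpen.measurableSet hsum, integral_finsetSum]
  · exact Finset.sum_eq_zero fun p _ => hzero p
  · intro p _
    exact ((continuous_tr_fderiv (hsm p)).integrable_of_hasCompactSupport
      (hasCompactSupport_tr_fderiv (hcs p))).integrableOn

/-! ### Nonlinear functionals on `L²` -/

/-- Composition of an `L²` function with a Lipschitz function. -/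
def lipComp {α : Type} [MeasurableSpace α] {μ : Measure α} [IsFiniteMeasure μ]
    {β : ℝ → ℝ} {K : ℝ≥0} (hβ : LipschitzWith K β) (g : Lp ℝ 2 μ) : Lp ℝ 2 μ :=
  -- Composition on `L²` needs a function vanishing at `0`; the constant `β 0` is added back, being
  -- square integrable on a finite measure space.
  LipschitzWith.compLp (g := fun s => β s - β 0) (c := K)
    (LipschitzWith.of_dist_le_mul fun x y => by simpa using hβ.dist_le_mul x y) (sub_self _) g
    + Lp.const 2 μ (β 0)

theorem coeFn_lipComp {α : Type} [MeasurableSpace α] {μ : Measure α} [IsFiniteMeasure μ]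
    {β : ℝ → ℝ} {K : ℝ≥0} (hβ : LipschitzWith K β) (g : Lp ℝ 2 μ) :
    lipComp hβ g =ᵐ[μ] fun x => β (g x) := by
  filter_upwards [Lp.coeFn_add (LipschitzWith.compLp (g := fun s => β s - β 0) (c := K)
    (LipschitzWith.of_dist_le_mul fun x y => by simpa using hβ.dist_le_mul x y) (sub_self _) g)
    (Lp.const 2 μ (β 0)), LipschitzWith.coeFn_compLp (g := fun s => β s - β 0) (c := K)
    (LipschitzWith.of_dist_le_mul fun x y => by simpa using hβ.dist_le_mul x y) (sub_self _) g,
    Lp.coeFn_const 2 μ (β 0)] with x h1 h2 h3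
  rw [lipComp, h1, Pi.add_apply, h2, h3]
  simp

theorem continuous_lipComp {α : Type} [MeasurableSpace α] {μ : Measure α} [IsFiniteMeasure μ]
    {β : ℝ → ℝ} {K : ℝ≥0} (hβ : LipschitzWith K β) :
    Continuous (lipComp hβ : Lp ℝ 2 μ → Lp ℝ 2 μ) :=
  (LipschitzWith.continuous_compLp _ _).add continuous_const

theorem integral_lip_mul_eq_inner {α : Type} [MeasurableSpace α] {μ : Measure α} [IsFiniteMeasure μ]
    {β : ℝ → ℝ} {K : ℝ≥0} (hβ : LipschitzWith K β)
    (g h : Lp ℝ 2 μ) : ∫ x, β (g x) * h x ∂μ = inner ℝ (lipComp hβ g) h := by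
  rw [L2.inner_def]
  refine integral_congr_ae ?_
  filter_upwards [coeFn_lipComp hβ g] with x hx
  rw [hx]; simp [mul_comm]

theorem continuous_integral_lip_mul {α : Type} [MeasurableSpace α] {μ : Measure α} [IsFiniteMeasure μ]
    {β : ℝ → ℝ} {K : ℝ≥0} (hβ : LipschitzWith K β) :
    Continuous fun p : Lp ℝ 2 μ × Lp ℝ 2 μ => ∫ x, β (p.1 x) * p.2 x ∂μ := by
  simp_rw [integral_lip_mul_eq_inner hβ]
  exact ((continuous_lipComp hβ).comp continuous_fst).inner continuous_snd

theorem integral_norm_sq_eq {α : Type} [MeasurableSpace α] {μ : Measure α}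
    {E : Type} [NormedAddCommGroup E] [InnerProductSpace ℝ E]
    (f : Lp E 2 μ) : ∫ x, ‖f x‖ ^ 2 ∂μ = ‖f‖ ^ 2 := by
  rw [← real_inner_self_eq_norm_sq f, L2.inner_def]
  simp_rw [real_inner_self_eq_norm_sq]

theorem integrable_norm_sq {α : Type} [MeasurableSpace α] {μ : Measure α}
    {E : Type} [NormedAddCommGroup E] (f : Lp E 2 μ) :
    Integrable (fun x => ‖f x‖ ^ 2) μ :=
  (Lp.memLp f).integrable_norm_pow two_ne_zero

theorem memLp_smul_of_bounded {α : Type} [MeasurableSpace α] {μ : Measure α}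
    {E : Type} [NormedAddCommGroup E] [NormedSpace ℝ E] {b : α → ℝ}
    {C : ℝ} (hb : AEStronglyMeasurable b μ) (hC : ∀ᵐ x ∂μ, |b x| ≤ C) (f : Lp E 2 μ) :
    MemLp (fun x => b x • f x) 2 μ := by
  refine MemLp.of_le_mul (c := C) (Lp.memLp f) (hb.smul (Lp.aestronglyMeasurable f)) ?_
  filter_upwards [hC] with x hx
  rw [norm_smul]
  exact mul_le_mul_of_nonneg_right hx (norm_nonneg _)

/-! ### Smooth functions and their gradients -/

theorem IsLipschitzDomain.isFiniteMeasure {Ω : Set E3} (hΩ : IsLipschitzDomain Ω) :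
    IsFiniteMeasure ((volume : Measure E3).restrict Ω) :=
  ⟨by simpa using hΩ.isBounded.measure_lt_top⟩

theorem inner_gradient_eq (φ : E3 → ℝ) (x y : E3) : inner ℝ (gradient φ x) y = fderiv ℝ φ x y := by
  rw [gradient, InnerProductSpace.toDual_symm_apply]

theorem contDiff_gradient {φ : E3 → ℝ} (hφ : ContDiff ℝ ∞ φ) : ContDiff ℝ 1 (gradient φ) := by
  have h : ContDiff ℝ 1 (fderiv ℝ φ) := 
    (contDiff_infty_iff_fderiv.1 hφ).2.of_le (by exact_mod_cast le_top)
  exact (InnerProductSpace.toDual ℝ E3).symm.toContinuousLinearEquiv.contDiff.comp h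

theorem fderiv_comp_eq {B β : ℝ → ℝ} (hB : ∀ s, HasDerivAt B (β s) s) {φ : E3 → ℝ}
    (hφ : ContDiff ℝ ∞ φ) (x y : E3) :
    fderiv ℝ (fun x => B (φ x)) x y = β (φ x) * inner ℝ (gradient φ x) y := by
  have hd : HasFDerivAt φ (fderiv ℝ φ x) x :=
    (hφ.differentiable (by simp) x).hasFDerivAt
  have := ((hB (φ x)).comp_hasFDerivAt x hd).fderiv
  have h2 := congrArg (fun l => l y) this
  rw [inner_gradient_eq]
  simpa [Function.comp_def] using h2

theorem integrableOn_of_continuous {Ω : Set E3} (hΩ : IsLipschitzDomain Ω) {f : E3 → ℝ}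
    (hf : Continuous f) : IntegrableOn f Ω :=
  (hf.continuousOn.integrableOn_compact hΩ.isBounded.isCompact_closure).mono_set subset_closure

/-- Green's formula for a smooth function satisfying the Neumann condition. -/
theorem NeumannZero.integral_mul_laplacian {Ω : Set E3} (hΩ : IsLipschitzDomain Ω) {φ : E3 → ℝ}
    (hφ : ContDiff ℝ ∞ φ) (hN : NeumannZero Ω φ) {β : ℝ → ℝ} (hβ : ContDiff ℝ 1 β) :
    ∫ x in Ω, β (φ x) * tr (fderiv ℝ (gradient φ) x)
      = -∫ x in Ω, deriv β (φ x) * ‖gradient φ x‖ ^ 2 := by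
  have hg := contDiff_gradient hφ
  have hβφ : ContDiff ℝ 1 fun x => β (φ x) := hβ.comp (hφ.of_le (by exact_mod_cast le_top))
  have h0 : ∫ x in Ω, tr (fderiv ℝ (fun x => β (φ x) • gradient φ x) x) = 0 :=
    hΩ.integral_tr_fderiv_eq_zero (hβφ.smul hg) (IsTangential.smul hN _)
  have h1 : ∀ x, tr (fderiv ℝ (fun x => β (φ x) • gradient φ x) x)
      = deriv β (φ x) * ‖gradient φ x‖ ^ 2 + β (φ x) * tr (fderiv ℝ (gradient φ) x) := by
    intro x
    rw [tr_fderiv_smul (hβφ.differentiable one_ne_zero x) (hg.differentiable one_ne_zero x),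
      fderiv_comp_eq (fun s => (hβ.differentiable one_ne_zero s).hasDerivAt) hφ,
      real_inner_self_eq_norm_sq]
  simp_rw [h1] at h0
  rw [integral_add] at h0
  · linarith
  · exact integrableOn_of_continuous hΩ
      (((hβ.continuous_deriv le_rfl).comp hφ.continuous).mul (hg.continuous.norm.pow 2))
  · exact integrableOn_of_continuous hΩ (hβφ.continuous.mul (continuous_tr_fderiv hg))

/-- For solenoidal `X` the integrand is the divergence of `B(φ) X`, which has compact support in
`Ω`; so no condition on `φ` at the boundary is needed. -/
theorem integral_mul_inner_gradient_eq_zero {Ω : Set E3} {X : E3 → E3}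
    (hX : IsTestField Ω X) (hdiv : ∀ x, tr (fderiv ℝ X x) = 0) {φ : E3 → ℝ}
    (hφ : ContDiff ℝ ∞ φ) {B β : ℝ → ℝ} (hB : ∀ s, HasDerivAt B (β s) s) (hβ : Continuous β) :
    ∫ x in Ω, β (φ x) * inner ℝ (X x) (gradient φ x) = 0 := by
  have hB1 : ContDiff ℝ 1 B := contDiff_one_iff_deriv.2
    ⟨fun s => (hB s).differentiableAt, by rwa [funext fun s => (hB s).deriv]⟩
  have hBφ : ContDiff ℝ 1 fun x => B (φ x) := hB1.comp (hφ.of_le (by exact_mod_cast le_top))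
  have hX1 : ContDiff ℝ 1 X := hX.1.of_le (by exact_mod_cast le_top)
  have h0 : ∫ x in Ω, tr (fderiv ℝ (fun x => B (φ x) • X x) x) = 0 :=
    integral_tr_fderiv_eq_zero_of_tsupport_subset (hBφ.smul hX1) (hX.2.1.smul_left (f := fun x => B (φ x)))
      ((tsupport_smul_subset_right (fun x => B (φ x)) X).trans hX.2.2)
  rw [← h0]
  refine integral_congr_ae (Eventually.of_forall fun x => ?_)
  simp only
  rw [tr_fderiv_smul (hBφ.differentiable one_ne_zero x) (hX1.differentiable one_ne_zero x),
    fderiv_comp_eq hB hφ, hdiv, mul_zero, add_zero, real_inner_comm]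

/-! ### Functions in `W^{2,2}_n` and solenoidal fields -/

/-- The Neumann condition is linear, so the difference of two solutions may itself be used in
Green's formula. -/
theorem sub_mem_W22n {Ω : Set E3} {J J' : Jet2 Ω} (h : J ∈ W22n Ω) (h' : J' ∈ W22n Ω) :
    J - J' ∈ W22n Ω := by
  refine map_mem_closure₂ continuous_sub h h' ?_
  rintro a ⟨φ, hφ, hN, h1, h2, h3⟩ b ⟨ψ, hψ, hM, k1, k2, k3⟩
  have hgrad : ∀ x, gradient (φ - ψ) x = gradient φ x - gradient ψ x := fun x => by
    rw [gradient, fderiv_sub (hφ.differentiable (by simp) x) (hψ.differentiable (by simp) x),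
      map_sub]
    rfl
  refine ⟨φ - ψ, hφ.sub hψ, fun p hp ν hν => ?_, ?_, ?_, ?_⟩
  · rw [hgrad, inner_sub_left, hN p hp ν hν, hM p hp ν hν, sub_zero]
  · filter_upwards [Lp.coeFn_sub a.1 b.1, h1, k1] with x e1 e2 e3
    rw [Prod.fst_sub, e1, Pi.sub_apply, Pi.sub_apply, e2, e3]
  · filter_upwards [Lp.coeFn_sub a.2.1 b.2.1, h2, k2] with x e1 e2 e3
    rw [Prod.snd_sub, Prod.fst_sub, e1, Pi.sub_apply, hgrad, e2, e3]
  · filter_upwards [Lp.coeFn_sub a.2.2 b.2.2, h3, k3] with x e1 e2 e3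
    rw [Prod.snd_sub, Prod.snd_sub, e1, Pi.sub_apply, e2, e3, funext hgrad]
    exact (fderiv_sub ((contDiff_gradient hφ).differentiable one_ne_zero x)
      ((contDiff_gradient hψ).differentiable one_ne_zero x)).symm

theorem sub_mem_L2div {Ω : Set E3} {v v' : L2 Ω E3} (h : v ∈ L2div Ω) (h' : v' ∈ L2div Ω) :
    v - v' ∈ L2div Ω := by
  refine map_mem_closure₂ continuous_sub h h' ?_
  rintro a ⟨φ, hφ, hN, h1⟩ b ⟨ψ, hψ, hM, k1⟩
  refine ⟨φ - ψ, ⟨hφ.1.sub hψ.1, hφ.2.1.sub hψ.2.1,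
    (tsupport_sub _ _).trans (union_subset hφ.2.2 hψ.2.2)⟩, fun x => ?_, ?_⟩
  · rw [fderiv_sub (hφ.1.differentiable (by simp) x) (hψ.1.differentiable (by simp) x)]
    have := map_sub trL (fderiv ℝ φ x) (fderiv ℝ ψ x)
    simpa [hN, hM] using this
  · filter_upwards [Lp.coeFn_sub a b, h1, k1] with x e1 e2 e3
    rw [e1, Pi.sub_apply, Pi.sub_apply, e2, e3]

/-- Diffusion is dissipative: `∫ β(c) Δc ≤ m ∫ |∇c|²` if `β' ≥ -m`. -/
theorem integral_mul_laplacian_le {Ω : Set E3} (hΩ : IsLipschitzDomain Ω) {β : ℝ → ℝ} {K : ℝ≥0}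
    (hβ : ContDiff ℝ 1 β) (hK : LipschitzWith K β) {m : ℝ} (hm : ∀ s, -m ≤ deriv β s)
    {J : Jet2 Ω} (hJ : J ∈ W22n Ω) :
    ∫ x in Ω, β (J.1 x) * tr (J.2.2 x) ≤ m * ∫ x in Ω, ‖J.2.1 x‖ ^ 2 := by
  have := hΩ.isFiniteMeasure
  have hL : ∀ J : Jet2 Ω, ∫ x in Ω, β (J.1 x) * tr (J.2.2 x)
      = ∫ x in Ω, β (J.1 x) * (trL.compLpL 2 (volume.restrict Ω) J.2.2) x := fun J => by
    refine integral_congr_ae ?_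
    filter_upwards [trL.coeFn_compLpL J.2.2] with x hx
    rw [hx, trL_apply]
  -- Both sides are continuous in the `W^{2,2}` norm: `J ↦ β(J.1)` is continuous into `L²` because
  -- `β` is Lipschitz, and the Laplacian depends linearly on `J`.
  have hcl : IsClosed {J : Jet2 Ω |
      ∫ x in Ω, β (J.1 x) * tr (J.2.2 x) ≤ m * ∫ x in Ω, ‖J.2.1 x‖ ^ 2} := by
    simp_rw [hL, integral_norm_sq_eq]
    refine isClosed_le ((continuous_integral_lip_mul hK).comp
      (continuous_fst.prodMk ((trL.compLpL 2 (volume.restrict Ω)).continuous.comp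
        (continuous_snd.comp continuous_snd)))) ?_
    fun_prop
  refine closure_minimal ?_ hcl hJ
  rintro J ⟨φ, hφ, hN, h1, h2, h3⟩
  have e1 : ∫ x in Ω, β (J.1 x) * tr (J.2.2 x)
      = ∫ x in Ω, β (φ x) * tr (fderiv ℝ (gradient φ) x) := by
    refine integral_congr_ae ?_
    filter_upwards [h1, h3] with x e1 e3
    rw [e1, e3]
  have e2 : ∫ x in Ω, ‖J.2.1 x‖ ^ 2 = ∫ x in Ω, ‖gradient φ x‖ ^ 2 := by
    refine integral_congr_ae ?_
    filter_upwards [h2] with x e2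
    rw [e2]
  have hg := (contDiff_gradient hφ).continuous.norm.pow 2
  rw [mem_ofPred_eq, e1, e2, hN.integral_mul_laplacian hΩ hφ hβ, ← integral_neg,
    ← integral_const_mul]
  refine integral_mono (integrableOn_of_continuous hΩ
      (((hβ.continuous_deriv le_rfl).comp hφ.continuous).mul hg)).neg
    (integrableOn_of_continuous hΩ (continuous_const.mul hg)) fun x => ?_
  have := mul_le_mul_of_nonneg_right (hm (φ x)) (sq_nonneg ‖gradient φ x‖)
  simp only
  linarith

/-- Transport by a solenoidal field conserves `∫ B(c)`. -/
theorem integral_mul_inner_eq_zero {Ω : Set E3} (hΩ : IsLipschitzDomain Ω) {B β : ℝ → ℝ}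
    (hB : ∀ s, HasDerivAt B (β s) s) {K : ℝ≥0} (hK : LipschitzWith K β) {C : ℝ}
    (hC : ∀ s, |β s| ≤ C) {J : Jet2 Ω} (hJ : J ∈ W22n Ω) {v : L2 Ω E3} (hv : v ∈ L2div Ω) :
    ∫ x in Ω, β (J.1 x) * inner ℝ (v x) (J.2.1 x) = 0 := by
  have := hΩ.isFiniteMeasure
  -- Density is used twice. For fixed `J`, boundedness of `β` puts `β(c)∇c` in `L²`, so the integral
  -- is continuous in `v`, which reduces to a smooth bounded field `X`. Only then is the integral
  -- shown to be continuous in `J`.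
  have hmem : MemLp (fun x => β (J.1 x) • J.2.1 x) 2 (volume.restrict Ω) :=
    memLp_smul_of_bounded (hK.continuous.comp_aestronglyMeasurable (Lp.aestronglyMeasurable _))
      (Eventually.of_forall fun x => hC _) _
  have e1 : ∀ v : L2 Ω E3, ∫ x in Ω, β (J.1 x) * inner ℝ (v x) (J.2.1 x)
      = inner ℝ v hmem.toLp := fun v => by
    rw [L2.inner_def]
    refine integral_congr_ae ?_
    filter_upwards [hmem.coeFn_toLp] with x hx
    rw [hx, real_inner_smul_right]
  have hcl : IsClosed {v : L2 Ω E3 |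
      ∫ x in Ω, β (J.1 x) * inner ℝ (v x) (J.2.1 x) = 0} := by
    simp_rw [e1]
    exact isClosed_eq (by fun_prop) continuous_const
  refine closure_minimal ?_ hcl hv
  rintro w ⟨X, hX, hdiv, hw⟩
  obtain ⟨M, hM⟩ := hX.2.1.exists_bound_of_continuous hX.1.continuous
  have hXm : MemLp X ⊤ (volume.restrict Ω) :=
    memLp_top_of_bound hX.1.continuous.aestronglyMeasurable M (Eventually.of_forall hM)
  set Λ := (innerSL ℝ (E := E3)).holderL (volume.restrict Ω) ⊤ 2 2 hXm.toLp
  have hΛ : ∀ J : Jet2 Ω, Λ J.2.1 =ᵐ[volume.restrict Ω] fun x => inner ℝ (X x) (J.2.1 x) := by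
    intro J
    filter_upwards [(innerSL ℝ (E := E3)).coeFn_holder (r := 2) hXm.toLp J.2.1,
      hXm.coeFn_toLp] with x h1 h2
    rw [h2] at h1
    exact h1
  have e2 : ∀ J : Jet2 Ω, ∫ x in Ω, β (J.1 x) * inner ℝ (X x) (J.2.1 x)
      = ∫ x in Ω, β (J.1 x) * (Λ J.2.1) x := fun J => by
    refine integral_congr_ae ?_
    filter_upwards [hΛ J] with x hx
    rw [hx]
  have hcl2 : IsClosed {J : Jet2 Ω |
      ∫ x in Ω, β (J.1 x) * inner ℝ (X x) (J.2.1 x) = 0} := by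
    simp_rw [e2]
    exact isClosed_eq ((continuous_integral_lip_mul hK).comp
      (continuous_fst.prodMk (Λ.continuous.comp (continuous_fst.comp continuous_snd))))
      continuous_const
  have hw' : ∫ x in Ω, β (J.1 x) * inner ℝ (w x) (J.2.1 x)
      = ∫ x in Ω, β (J.1 x) * inner ℝ (X x) (J.2.1 x) := by
    refine integral_congr_ae ?_
    filter_upwards [hw] with x hx
    rw [hx]
  rw [mem_ofPred_eq, hw']
  refine closure_minimal ?_ hcl2 hJ
  rintro J' ⟨φ, hφ, -, h1, h2, -⟩
  rw [mem_ofPred_eq, ← integral_mul_inner_gradient_eq_zero hX hdiv hφ hB hK.continuous]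
  refine integral_congr_ae ?_
  filter_upwards [h1, h2] with x k1 k2
  rw [k1, k2]

/-! ### The chain rule for `∫ B(w)` along absolutely continuous curves in `L¹` -/

theorem abs_sub_le_of_hasDerivAt {B β : ℝ → ℝ} (hB : ∀ s, HasDerivAt B (β s) s) {C : ℝ}
    (hC : ∀ s, |β s| ≤ C) (r s : ℝ) : |B r - B s| ≤ C * |r - s| :=
  convex_univ.norm_image_sub_le_of_norm_hasDerivWithin_le
    (fun x _ => (hB x).hasDerivWithinAt) (fun x _ => hC x) (mem_univ s) (mem_univ r)

theorem continuous_of_hasDerivAt {B β : ℝ → ℝ} (hB : ∀ s, HasDerivAt B (β s) s) :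
    Continuous B :=
  continuous_iff_continuousAt.2 fun s => (hB s).continuousAt

theorem integrable_comp_of_hasDerivAt {α : Type} [MeasurableSpace α] {μ : Measure α}
    [IsFiniteMeasure μ] {B β : ℝ → ℝ} (hB : ∀ s, HasDerivAt B (β s) s) {C : ℝ}
    (hC : ∀ s, |β s| ≤ C) {g : α → ℝ} (hg : Integrable g μ) :
    Integrable (fun x => B (g x)) μ := by
  refine Integrable.mono' ((integrable_const |B 0|).add (hg.norm.const_mul C))
    ((continuous_of_hasDerivAt hB).comp_aestronglyMeasurable hg.1)
    (Eventually.of_forall fun x => ?_)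
  have h1 := abs_sub_le_of_hasDerivAt hB hC (g x) 0
  have h2 := abs_sub_abs_le_abs_sub (B (g x)) (B 0)
  rw [sub_zero] at h1
  simp only [Pi.add_apply, Real.norm_eq_abs]
  linarith

/-- Since `g ↦ ∫ B(g)` is Lipschitz on `L¹`, absolute continuity and first-order behaviour pass from
a curve in `L¹` to the real function `∫ B(W t)`. -/
theorem abs_integral_comp_sub_le {α : Type} [MeasurableSpace α] {μ : Measure α}
    [IsFiniteMeasure μ] {B β : ℝ → ℝ} (hB : ∀ s, HasDerivAt B (β s) s) {C : ℝ}
    (hC : ∀ s, |β s| ≤ C) (g h : Lp ℝ 1 μ) :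
    |∫ x, B (g x) ∂μ - ∫ x, B (h x) ∂μ| ≤ C * ‖g - h‖ := by
  have hg := L1.integrable_coeFn g
  have hh := L1.integrable_coeFn h
  rw [← integral_sub (integrable_comp_of_hasDerivAt hB hC hg)
    (integrable_comp_of_hasDerivAt hB hC hh), L1.norm_eq_integral_norm, ← integral_const_mul]
  refine (norm_integral_le_integral_norm (fun x => B (g x) - B (h x))).trans
    (integral_mono_ae ?_ ?_ ?_)
  · exact ((integrable_comp_of_hasDerivAt hB hC hg).sub
      (integrable_comp_of_hasDerivAt hB hC hh)).norm
  · exact (L1.integrable_coeFn (g - h)).norm.const_mul C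
  · filter_upwards [Lp.coeFn_sub g h] with x hx
    rw [hx]
    exact abs_sub_le_of_hasDerivAt hB hC _ _

theorem hasDerivAt_integral_comp_line {α : Type} [MeasurableSpace α] {μ : Measure α}
    [IsFiniteMeasure μ] {B β : ℝ → ℝ} (hB : ∀ s, HasDerivAt B (β s) s) (hβ : Continuous β) {C : ℝ}
    (hC : ∀ s, |β s| ≤ C) (g h : Lp ℝ 1 μ) :
    HasDerivAt (fun t : ℝ => ∫ x, B ((g + t • h : Lp ℝ 1 μ) x) ∂μ)
      (∫ x, β (g x) * h x ∂μ) 0 := by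
  have hg := L1.integrable_coeFn g
  have hh := L1.integrable_coeFn h
  have e : (fun t : ℝ => ∫ x, B ((g + t • h : Lp ℝ 1 μ) x) ∂μ)
      = fun t => ∫ x, B (g x + t * h x) ∂μ := by
    funext t
    refine integral_congr_ae ?_
    filter_upwards [Lp.coeFn_add g (t • h), Lp.coeFn_smul t h] with x h1 h2
    rw [h1, Pi.add_apply, h2]; rfl
  have hl : ∀ t : ℝ, Integrable (fun x => g x + t * h x) μ := fun t => hg.add (hh.const_mul t)
  rw [e]
  have := (hasDerivAt_integral_of_dominated_loc_of_deriv_le (μ := μ) (x₀ := (0 : ℝ)) (s := univ)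
    (F := fun t x => B (g x + t * h x)) (F' := fun t x => β (g x + t * h x) * h x)
    (bound := fun x => C * |h x|) univ_mem
    (Eventually.of_forall fun t => (continuous_of_hasDerivAt hB).comp_aestronglyMeasurable (hl t).1)
    (integrable_comp_of_hasDerivAt hB hC (hl 0))
    ((hβ.comp_aestronglyMeasurable (hl 0).1).mul hh.1)
    (Eventually.of_forall fun x t _ => ?_) (hh.norm.const_mul C)
    (Eventually.of_forall fun x t _ => ?_)).2
  · simpa using this
  · rw [norm_mul]
    exact mul_le_mul_of_nonneg_right (hC _) (norm_nonneg _)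
  · have h1 : HasDerivAt (fun t : ℝ => g x + t * h x) (h x) t := by
      simpa using ((hasDerivAt_id t).mul_const (h x)).const_add (g x)
    exact (hB _).comp t h1

/-- The curve differs from its tangent line by `o(|r - t|)` in `L¹`, which a Lipschitz functional
does not see to first order. The derivative is thus the one along the line; Fréchet
differentiability on `L¹` is not used. -/
theorem hasDerivAt_integral_comp {α : Type} [MeasurableSpace α] {μ : Measure α}
    [IsFiniteMeasure μ] {B β : ℝ → ℝ} (hB : ∀ s, HasDerivAt B (β s) s) (hβ : Continuous β) {C : ℝ}
    (hC : ∀ s, |β s| ≤ C) {W : ℝ → Lp ℝ 1 μ} {h : Lp ℝ 1 μ} {t : ℝ} (hW : HasDerivAt W h t) :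
    HasDerivAt (fun t => ∫ x, B (W t x) ∂μ) (∫ x, β (W t x) * h x ∂μ) t := by
  have h1 : HasDerivAt (fun r : ℝ => ∫ x, B ((W t + (r - t) • h : Lp ℝ 1 μ) x) ∂μ)
      (∫ x, β (W t x) * h x ∂μ) t := by
    have h0 := hasDerivAt_integral_comp_line hB hβ hC (W t) h
    rw [← sub_self t] at h0
    exact h0.comp_sub_const t t
  have h2 : HasDerivAt (fun r : ℝ => ∫ x, B (W r x) ∂μ
      - ∫ x, B ((W t + (r - t) • h : Lp ℝ 1 μ) x) ∂μ) 0 t := by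
    rw [hasDerivAt_iff_isLittleO]
    refine Asymptotics.IsBigO.trans_isLittleO (g := fun r => W r - W t - (r - t) • h) ?_
      (hasDerivAt_iff_isLittleO.1 hW)
    refine Asymptotics.IsBigO.of_bound C (Eventually.of_forall fun r => ?_)
    have := abs_integral_comp_sub_le hB hC (W r) (W t + (r - t) • h)
    simpa [sub_add_eq_sub_sub] using this
  have h3 := h2.add h1
  rw [zero_add] at h3
  refine h3.congr_of_eventuallyEq (Eventually.of_forall fun r => ?_)
  simp

theorem absolutelyContinuousOnInterval_of_abs_sub_le {f N : ℝ → ℝ} {a b C : ℝ}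
    (hN : AbsolutelyContinuousOnInterval N a b) (h : ∀ s t, |f s - f t| ≤ C * |N s - N t|) :
    AbsolutelyContinuousOnInterval f a b := by
  refine squeeze_zero (fun E => Finset.sum_nonneg fun _ _ => dist_nonneg) (fun E => ?_)
    (by simpa using Tendsto.const_mul C hN)
  rw [Finset.mul_sum]
  exact Finset.sum_le_sum fun i _ => h _ _

theorem continuous_primitive_of_integrable {X : Type} [NormedAddCommGroup X] [NormedSpace ℝ X]
    {d : ℝ → X} (hd : Integrable d) (w₀ : X) : Continuous fun t => w₀ + ∫ s in (0 : ℝ)..t, d s :=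
  continuous_const.add (intervalIntegral.continuous_primitive
    (fun _ _ => hd.intervalIntegrable) 0)

theorem continuous_integral_comp_primitive {α : Type} [MeasurableSpace α] {μ : Measure α}
    [IsFiniteMeasure μ] {B β : ℝ → ℝ} (hB : ∀ s, HasDerivAt B (β s) s) {C : ℝ}
    (hC : ∀ s, |β s| ≤ C) {d : ℝ → Lp ℝ 1 μ} (hd : Integrable d) (w₀ : Lp ℝ 1 μ) :
    Continuous fun t => ∫ x, B ((w₀ + ∫ s in (0 : ℝ)..t, d s : Lp ℝ 1 μ) x) ∂μ := by
  have hC0 : 0 ≤ C := (abs_nonneg _).trans (hC 0)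
  have h : LipschitzWith ⟨C, hC0⟩ fun g : Lp ℝ 1 μ => ∫ x, B (g x) ∂μ :=
    LipschitzWith.of_dist_le_mul fun g h => by
      rw [dist_eq_norm g h]
      exact abs_integral_comp_sub_le hB hC g h
  exact h.continuous.comp (continuous_primitive_of_integrable hd w₀)

/-- The energy inequality obtained by integrating the chain rule. -/
theorem integral_comp_primitive_le {α : Type} [MeasurableSpace α] {μ : Measure α}
    [IsFiniteMeasure μ] {B β : ℝ → ℝ} (hB : ∀ s, HasDerivAt B (β s) s) (hβ : Continuous β) {C : ℝ}
    (hC : ∀ s, |β s| ≤ C) {d : ℝ → Lp ℝ 1 μ} (hd : Integrable d) (w₀ : Lp ℝ 1 μ) {T : ℝ}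
    {g : ℝ → ℝ} (hg : IntervalIntegrable g volume 0 T)
    (h : ∀ᵐ t ∂(volume.restrict (Ioo 0 T)),
      ∫ x, β ((w₀ + ∫ s in (0 : ℝ)..t, d s : Lp ℝ 1 μ) x) * d t x ∂μ ≤ g t)
    {t : ℝ} (ht : t ∈ Icc 0 T) :
    ∫ x, B ((w₀ + ∫ s in (0 : ℝ)..t, d s : Lp ℝ 1 μ) x) ∂μ
      ≤ ∫ x, B (w₀ x) ∂μ + ∫ s in (0 : ℝ)..t, g s := by
  set W : ℝ → Lp ℝ 1 μ := fun t => w₀ + ∫ s in (0 : ℝ)..t, d s with hW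
  set y : ℝ → ℝ := fun t => ∫ x, B (W t x) ∂μ with hy
  have hC0 : 0 ≤ C := (abs_nonneg _).trans (hC 0)
  have hii : ∀ a b : ℝ, IntervalIntegrable d volume a b := fun _ _ => hd.intervalIntegrable
  have hN : AbsolutelyContinuousOnInterval (fun t => ∫ s in (0 : ℝ)..t, ‖d s‖) 0 t :=
    IntervalIntegrable.absolutelyContinuousOnInterval_intervalIntegral
      hd.norm.intervalIntegrable left_mem_uIcc
  -- The increments of `y` are at most `C` times those of `∫ ‖d‖`.
  have hAC : AbsolutelyContinuousOnInterval y 0 t := by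
    refine absolutelyContinuousOnInterval_of_abs_sub_le (C := C) hN fun r s => ?_
    refine (abs_integral_comp_sub_le hB hC (W r) (W s)).trans (mul_le_mul_of_nonneg_left ?_ hC0)
    rw [hW]
    simp only
    rw [add_sub_add_left_eq_sub, intervalIntegral.integral_interval_sub_left (hii _ _) (hii _ _),
      intervalIntegral.integral_interval_sub_left hd.norm.intervalIntegrable
        hd.norm.intervalIntegrable]
    exact intervalIntegral.norm_integral_le_abs_integral_norm
  have hder : ∀ᵐ s, HasDerivAt y (∫ x, β (W s x) * d s x ∂μ) s := by
    filter_upwards [_root_.LocallyIntegrable.ae_hasDerivAt_integral hd.locallyIntegrable] with s hs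
    exact hasDerivAt_integral_comp hB hβ hC ((hs 0).const_add w₀)
  have h0 : y 0 = ∫ x, B (w₀ x) ∂μ := by simp [hy, hW]
  have key : ∫ s in (0 : ℝ)..t, deriv y s ≤ ∫ s in (0 : ℝ)..t, g s := by
    refine intervalIntegral.integral_mono_ae_restrict ht.1 hAC.intervalIntegrable_deriv
      (hg.mono_set (by rw [uIcc_of_le ht.1, uIcc_of_le (ht.1.trans ht.2)]
                       exact Icc_subset_Icc_right ht.2)) ?_
    have h' := (ae_restrict_iff' measurableSet_Ioo).1 h
    rw [Filter.EventuallyLE, ae_restrict_iff' measurableSet_Icc]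
    have hne0 : ∀ᵐ s : ℝ, s ≠ 0 := by simp [ae_iff, measure_singleton]
    have hneT : ∀ᵐ s : ℝ, s ≠ T := by simp [ae_iff, measure_singleton]
    filter_upwards [h', hder, hne0, hneT] with s h1 h2 h3 h4 h5
    rw [h2.deriv]
    exact h1 ⟨lt_of_le_of_ne h5.1 (Ne.symm h3), lt_of_le_of_ne (h5.2.trans ht.2) h4⟩
  rw [hAC.integral_deriv_eq_sub] at key
  change y t ≤ _
  linarith

/-- Grönwall's inequality in integral form. -/
theorem le_mul_exp_of_le_integral {y g : ℝ → ℝ} {a A T : ℝ} (hy : Continuous y)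
    (hg : IntervalIntegrable g volume 0 T) (hg0 : ∀ s, 0 ≤ g s) (ha : 0 ≤ a) (hA : 0 ≤ A)
    (h : ∀ t ∈ Icc 0 T, y t ≤ ∫ s in (0 : ℝ)..t, (a * y s + A * g s)) {t : ℝ}
    (ht : t ∈ Icc 0 T) : y t ≤ A * Real.exp (a * T) * ∫ s in (0 : ℝ)..t, g s := by
  have hgi : ∀ s ∈ Icc 0 T, IntervalIntegrable g volume 0 s := fun s hs =>
    hg.mono_set (by
      rw [uIcc_of_le hs.1, uIcc_of_le (hs.1.trans hs.2)]
      exact Icc_subset_Icc_right hs.2)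
  set G := ∫ s in (0 : ℝ)..t, g s with hG
  have hG0 : 0 ≤ G := intervalIntegral.integral_nonneg ht.1 fun s _ => hg0 s
  -- The contribution of `g` is frozen at its value `G` at the final time. This majorant is
  -- differentiable, with `z' = a y ≤ a z`, although `g` is merely integrable.
  set z : ℝ → ℝ := fun s => a * (∫ r in (0 : ℝ)..s, y r) + A * G with hz
  have hyz : ∀ s ∈ Icc 0 t, y s ≤ z s := by
    intro s hs
    have hsT : s ∈ Icc 0 T := ⟨hs.1, hs.2.trans ht.2⟩
    refine (h s hsT).trans ?_
    rw [intervalIntegral.integral_add ((hy.intervalIntegrable _ _).const_mul a)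
      ((hgi s hsT).const_mul A), intervalIntegral.integral_const_mul,
      intervalIntegral.integral_const_mul, hz]
    have : ∫ r in (0 : ℝ)..s, g r ≤ G :=
      intervalIntegral.integral_mono_interval le_rfl hs.1 hs.2
        (Eventually.of_forall hg0) (hgi t ht)
    have := mul_le_mul_of_nonneg_left this hA
    simp only
    linarith
  have hzd : ∀ s, HasDerivAt z (a * y s) s := fun s =>
    ((intervalIntegral.integral_hasDerivAt_right (hy.intervalIntegrable _ _)
      (hy.stronglyMeasurableAtFilter _ _) hy.continuousAt).const_mul a).add_const _
  have hgr := le_gronwallBound_of_liminf_deriv_right_le (f := z) (f' := fun s => a * y s)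
    (δ := A * G) (K := a) (ε := 0) (a := 0) (b := t)
    (fun s _ => (hzd s).continuousAt.continuousWithinAt)
    (fun s _ r hr => ((hzd s).hasDerivWithinAt.liminf_right_slope_le hr).mono fun w hw => by
      simpa [slope_def_field, div_eq_inv_mul] using hw)
    (by simp [hz]) (fun s hs => by
      rw [add_zero]
      exact mul_le_mul_of_nonneg_left (hyz s ⟨hs.1, hs.2.le⟩) ha) t ⟨ht.1, le_rfl⟩
  rw [gronwallBound_ε0, sub_zero] at hgr
  have hexp : Real.exp (a * t) ≤ Real.exp (a * T) :=
    Real.exp_le_exp.2 (mul_le_mul_of_nonneg_left ht.2 ha)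
  calc y t ≤ z t := hyz t ⟨ht.1, le_rfl⟩
    _ ≤ A * G * Real.exp (a * t) := hgr
    _ ≤ A * G * Real.exp (a * T) := mul_le_mul_of_nonneg_left hexp (mul_nonneg hA hG0)
    _ = A * Real.exp (a * T) * G := by ring

/-! ### Solutions as absolutely continuous curves in `L¹(Ω)` -/

/-- Pairing of an `L¹` function with a bounded function. -/
theorem exists_pairing {α : Type} [MeasurableSpace α] {μ : Measure α} {η : α → ℝ}
    (hη : MemLp η ⊤ μ) :
    ∃ P : Lp ℝ 1 μ →L[ℝ] ℝ, ∀ g : Lp ℝ 1 μ, P g = ∫ x, g x * η x ∂μ := by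
  refine ⟨((ContinuousLinearMap.mul ℝ ℝ).lpPairing μ 1 ⊤).flip hη.toLp, fun g => ?_⟩
  rw [ContinuousLinearMap.flip_apply, ContinuousLinearMap.lpPairing_eq_integral]
  refine integral_congr_ae ?_
  filter_upwards [hη.coeFn_toLp] with x hx
  rw [hx]; rfl

/-- The inclusion of `L²` in `L¹` on a finite measure space. -/
def toL1 {α : Type} [MeasurableSpace α] {μ : Measure α} [IsFiniteMeasure μ] :
    Lp ℝ 2 μ →L[ℝ] Lp ℝ 1 μ :=
  ((ContinuousLinearMap.mul ℝ ℝ).holderL μ 2 2 1).flip (Lp.const 2 μ 1)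

theorem coeFn_toL1 {α : Type} [MeasurableSpace α] {μ : Measure α} [IsFiniteMeasure μ]
    (g : Lp ℝ 2 μ) : toL1 g =ᵐ[μ] g := by
  filter_upwards [(ContinuousLinearMap.mul ℝ ℝ).coeFn_holder (r := 1) g (Lp.const 2 μ 1),
    Lp.coeFn_const 2 μ (1 : ℝ)] with x h1 h2
  rw [h2] at h1
  simpa [toL1] using h1

/-- A test function on `(-∞, T)` whose derivative on `(0, T)` is a given test function. -/
theorem exists_test_primitive {T : ℝ} (hT : 0 < T) {χ : ℝ → ℝ} (hχ : ContDiff ℝ ∞ χ)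
    (hc : HasCompactSupport χ) (hs : tsupport χ ⊆ Ioo 0 T) :
    ∃ θ : ℝ → ℝ, ContDiff ℝ ∞ θ ∧ HasCompactSupport θ ∧ tsupport θ ⊆ Iio T ∧
      ∀ t ∈ Ioo 0 T, deriv θ t = χ t := by
  -- Integrating from `T` makes `g` vanish near `T`. Test functions need not vanish at time `0`, so
  -- `χ` needs no zero mean.
  set g : ℝ → ℝ := fun t => ∫ s in T..t, χ s with hg
  have hgd : ∀ t, HasDerivAt g (χ t) t := fun t => hχ.continuous.integral_hasStrictDerivAt T t |>.hasDerivAt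
  have hgs : ContDiff ℝ ∞ g := contDiff_infty_iff_deriv.2
    ⟨fun t => (hgd t).differentiableAt, by rwa [funext fun t => (hgd t).deriv]⟩
  obtain ⟨b, hbT, hb⟩ : ∃ b < T, ∀ t, b ≤ t → χ t = 0 := by
    rcases (tsupport χ).eq_empty_or_nonempty with he | hne
    · refine ⟨0, hT, fun t _ => image_eq_zero_of_notMem_tsupport (by simp [he])⟩
    · obtain ⟨m, hm, hmax⟩ := hc.isCompact.exists_isMaxOn hne continuousOn_id
      refine ⟨(m + T) / 2, by linarith [(hs hm).2], fun t ht => ?_⟩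
      refine image_eq_zero_of_notMem_tsupport fun h => ?_
      have := hmax h
      simp only [id, mem_ofPred_eq] at this
      linarith [(hs hm).2]
  have hg0 : ∀ t, b ≤ t → g t = 0 := fun t ht => by
    rw [hg]
    refine intervalIntegral.integral_zero_ae (Eventually.of_forall fun s hs => hb s ?_)
    rw [uIoc, mem_Ioc] at hs
    exact (le_min hbT.le ht).trans hs.1.le
  -- The factor is `0` for `t ≤ -2` and `1` for `t ≥ -1`, so it removes the left tail without
  -- changing `g` on `(0, T)`.
  have hsub : tsupport (fun t => Real.smoothTransition (t + 2) * g t) ⊆ Icc (-2) b := by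
    refine closure_minimal (fun t ht => ?_) isClosed_Icc
    rw [Function.mem_support] at ht
    constructor
    · by_contra! h
      exact ht (by rw [Real.smoothTransition.zero_of_nonpos (by linarith), zero_mul])
    · by_contra! h
      exact ht (by rw [hg0 t h.le, mul_zero])
  refine ⟨fun t => Real.smoothTransition (t + 2) * g t, ?_, ?_, ?_, fun t ht => ?_⟩
  · exact (Real.smoothTransition.contDiff.comp (contDiff_id.add contDiff_const)).mul hgs
  · exact isCompact_Icc.of_isClosed_subset (isClosed_tsupport _) hsub
  · exact hsub.trans fun t ht => ht.2.trans_lt hbT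
  · have h : (fun t => Real.smoothTransition (t + 2) * g t) =ᶠ[𝓝 t] g := by
      filter_upwards [Ioi_mem_nhds ht.1] with r hr
      rw [Real.smoothTransition.one_of_one_le (by linarith [mem_Ioi.1 hr]), one_mul]
    rw [h.deriv_eq, (hgd t).deriv]

/-- Integration by parts in time for a primitive and a test function on `(-∞, T)`. -/
theorem integral_test_mul_primitive {T : ℝ} (hT : 0 < T) {b : ℝ → ℝ} (hb : Integrable b) (a₀ : ℝ)
    {θ : ℝ → ℝ} (hθ : ContDiff ℝ ∞ θ) (hs : tsupport θ ⊆ Iio T) :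
    ∫ t in Ioo 0 T, (a₀ + ∫ s in (0 : ℝ)..t, b s) * deriv θ t
      = -(a₀ * θ 0) - ∫ t in Ioo 0 T, b t * θ t := by
  have hθT : θ T = 0 := image_eq_zero_of_notMem_tsupport fun h => lt_irrefl T (hs h)
  have hA : AbsolutelyContinuousOnInterval (fun t => a₀ + ∫ s in (0 : ℝ)..t, b s) 0 T :=
    absolutelyContinuousOnInterval_of_abs_sub_le (C := 1)
      (IntervalIntegrable.absolutelyContinuousOnInterval_intervalIntegral
        (f := b) hb.intervalIntegrable left_mem_uIcc) fun r s => by simp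
  have hθA : AbsolutelyContinuousOnInterval θ 0 T :=
    (hθ.of_le (by exact_mod_cast le_top) : ContDiff ℝ 1 θ).contDiffOn.absolutelyContinuousOnInterval
  have h := hA.integral_mul_deriv_eq_deriv_mul hθA
  have hd : ∫ t in (0 : ℝ)..T, deriv (fun t => a₀ + ∫ s in (0 : ℝ)..t, b s) t * θ t
      = ∫ t in (0 : ℝ)..T, b t * θ t := by
    refine intervalIntegral.integral_congr_ae ?_
    filter_upwards [_root_.LocallyIntegrable.ae_hasDerivAt_integral hb.locallyIntegrable] with t ht _
    rw [((ht 0).const_add a₀).deriv]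
  rw [hd, hθT, intervalIntegral.integral_same] at h
  have hset : ∀ f : ℝ → ℝ, ∫ t in (0 : ℝ)..T, f t = ∫ t in Ioo 0 T, f t := fun f => by
    rw [intervalIntegral.integral_of_le hT.le, integral_Ioc_eq_integral_Ioo]
  rw [hset (fun t => (a₀ + ∫ s in (0 : ℝ)..t, b s) * deriv θ t), hset (fun t => b t * θ t)] at h
  rw [h]; ring

/-- The weak time derivative tested with a product `θ(t) η(x)`. -/
theorem HasWeakTimeDeriv.integral_pairing {Ω : Set E3} {T : ℝ} {c : ℝ → L2 Ω ℝ} {c₀ : L2 Ω ℝ}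
    {d : ℝ → Lp ℝ 1 (volume.restrict Ω)} (h : HasWeakTimeDeriv Ω T c c₀ d) {θ : ℝ → ℝ}
    (hθ : ContDiff ℝ ∞ θ) (hθc : HasCompactSupport θ) (hθs : tsupport θ ⊆ Iio T) {η : E3 → ℝ}
    (hη : ContDiff ℝ ∞ η) (hηc : HasCompactSupport η) (hηs : tsupport η ⊆ Ω) :
    ∫ t in Ioo 0 T, (∫ x in Ω, c t x * η x) * deriv θ t
      = -((∫ x in Ω, c₀ x * η x) * θ 0) - ∫ t in Ioo 0 T, (∫ x in Ω, d t x * η x) * θ t := by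
  have hsub : tsupport (fun q : ℝ × E3 => θ q.1 * η q.2) ⊆ tsupport θ ×ˢ tsupport η :=
    closure_minimal (fun q hq => ⟨subset_tsupport _ (left_ne_zero_of_mul hq),
      subset_tsupport _ (right_ne_zero_of_mul hq)⟩)
      ((isClosed_tsupport θ).prod (isClosed_tsupport η))
  have e := h (fun q => θ q.1 * η q.2) ((hθ.comp contDiff_fst).mul (hη.comp contDiff_snd))
    ((hθc.isCompact.prod hηc.isCompact).of_isClosed_subset (isClosed_tsupport _) hsub)
    (hsub.trans (prod_mono hθs hηs))
  have hd : ∀ t x, deriv (fun s => θ s * η x) t = deriv θ t * η x := fun t x =>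
    deriv_mul_const (hθ.differentiable (by simp) t) _
  have hm : ∀ (f : E3 → ℝ) (r : ℝ), ∫ x in Ω, f x * (r * η x) = (∫ x in Ω, f x * η x) * r :=
    fun f r => by
      rw [← integral_mul_const]
      congr 1; funext x; ring
  simp only [hd, hm] at e
  exact e

-- Paired with a spatial test function `η`, the identity is the weak formulation for `θ(t) η(x)`,
-- where `θ' = χ` on `(0, T)`, minus integration by parts for the primitive. Keeping the time
-- integral `L¹`-valued avoids null sets of times depending on `η`: the fundamental lemma is applied
-- in space here, and in time afterwards.
set_option maxHeartbeats 800000 in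
theorem HasWeakTimeDeriv.integral_smul_sub_primitive {Ω : Set E3} (hΩ : IsOpen Ω)
    [IsFiniteMeasure ((volume : Measure E3).restrict Ω)] {T : ℝ} (hT : 0 < T) {c : ℝ → L2 Ω ℝ}
    (hc : Integrable c (volume.restrict (Ioo 0 T))) {c₀ : L2 Ω ℝ}
    {d : ℝ → Lp ℝ 1 (volume.restrict Ω)} (h : HasWeakTimeDeriv Ω T c c₀ d)
    (hd : Integrable ((Ioo 0 T).indicator d)) {χ : ℝ → ℝ} (hχ : ContDiff ℝ ∞ χ)
    (hχc : HasCompactSupport χ) (hχs : tsupport χ ⊆ Ioo 0 T) :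
    ∫ t in Ioo 0 T, χ t • (toL1 (c t)
      - (toL1 c₀ + ∫ s in (0 : ℝ)..t, (Ioo 0 T).indicator d s)) = 0 := by
  set W : ℝ → Lp ℝ 1 (volume.restrict Ω) :=
    fun t => toL1 c₀ + ∫ s in (0 : ℝ)..t, (Ioo 0 T).indicator d s with hW
  have hcI : IntegrableOn (fun t => toL1 (c t)) (Ioo 0 T) := toL1.integrable_comp hc
  have hWI : IntegrableOn W (Ioo 0 T) :=
    ((continuous_primitive_of_integrable hd _).continuousOn.integrableOn_compact
      isCompact_Icc).mono_set Ioo_subset_Icc_self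
  obtain ⟨M, hM⟩ := hχc.exists_bound_of_continuous hχ.continuous
  have hχf : IntegrableOn (fun t => χ t • (toL1 (c t) - W t)) (Ioo 0 T) :=
    (hcI.sub hWI).bdd_smul M hχ.continuous.aestronglyMeasurable (Eventually.of_forall hM)
  change ∫ t in Ioo 0 T, χ t • (toL1 (c t) - W t) = 0
  set z := ∫ t in Ioo 0 T, χ t • (toL1 (c t) - W t)
  obtain ⟨θ, hθ, hθc, hθs, hθχ⟩ := exists_test_primitive hT hχ hχc hχs
  have hz : ∀ η : E3 → ℝ, ContDiff ℝ ∞ η → HasCompactSupport η → tsupport η ⊆ Ω →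
      ∫ x in Ω, z x * η x = 0 := by
    intro η hη hηc hηs
    obtain ⟨N, hN⟩ := hηc.exists_bound_of_continuous hη.continuous
    obtain ⟨P, hP⟩ := exists_pairing (μ := volume.restrict Ω)
      (memLp_top_of_bound hη.continuous.aestronglyMeasurable N (Eventually.of_forall hN))
    have hP2 : ∀ g : L2 Ω ℝ, P (toL1 g) = ∫ x in Ω, g x * η x := fun g => by
      rw [hP]
      refine integral_congr_ae ?_
      filter_upwards [coeFn_toL1 g] with x hx
      rw [hx]
    have hPW : ∀ t, P (W t)
        = P (toL1 c₀) + ∫ s in (0 : ℝ)..t, P ((Ioo 0 T).indicator d s) := fun t => by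
      rw [hW, map_add, P.intervalIntegral_comp_comm hd.intervalIntegrable]
    have hI : ∀ f : ℝ → Lp ℝ 1 (volume.restrict Ω), IntegrableOn f (Ioo 0 T) →
        IntegrableOn (fun t => P (f t) * χ t) (Ioo 0 T) := fun f hf => by
      simp_rw [mul_comm _ (χ _)]
      exact (P.integrable_comp hf).bdd_mul hχ.continuous.aestronglyMeasurable
        (Eventually.of_forall hM)
    have e1 : P z = ∫ t in Ioo 0 T, (P (toL1 (c t)) * χ t - P (W t) * χ t) := by
      rw [← P.integral_comp_comm hχf]
      congr 1; funext t
      rw [map_smul, map_sub, smul_eq_mul]; ring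
    have e2 := h.integral_pairing hθ hθc hθs hη hηc hηs
    have e3 : ∫ t in Ioo 0 T, (∫ x in Ω, c t x * η x) * deriv θ t
        = ∫ t in Ioo 0 T, P (toL1 (c t)) * χ t :=
      setIntegral_congr_fun measurableSet_Ioo fun t ht => by
        simp only [hP2, hθχ t ht]
    have e5 : ∫ t in Ioo 0 T, (∫ x in Ω, d t x * η x) * θ t
        = ∫ t in Ioo 0 T, P ((Ioo 0 T).indicator d t) * θ t :=
      setIntegral_congr_fun measurableSet_Ioo fun t ht => by
        simp only [indicator_of_mem ht, hP]
    have e6 := integral_test_mul_primitive hT (P.integrable_comp hd) (P (toL1 c₀)) hθ hθs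
    have e7 : ∫ t in Ioo 0 T, (P (toL1 c₀) + ∫ s in (0 : ℝ)..t, P ((Ioo 0 T).indicator d s))
        * deriv θ t = ∫ t in Ioo 0 T, P (W t) * χ t :=
      setIntegral_congr_fun measurableSet_Ioo fun t ht => by
        simp only [hθχ t ht, hPW]
    rw [e3, e5, ← hP2] at e2
    rw [e7] at e6
    have hI1 : Integrable (fun t => P (toL1 (c t)) * χ t) (volume.restrict (Ioo 0 T)) := hI _ hcI
    have hI2 : Integrable (fun t => P (W t) * χ t) (volume.restrict (Ioo 0 T)) := hI _ hWI
    have e8 := integral_sub hI1 hI2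
    rw [← hP]
    exact e1.trans (e8.trans (sub_eq_zero.2 (e2.trans e6.symm)))
  have hz0 : ∀ᵐ x, x ∈ Ω → z x = 0 := by
    refine hΩ.ae_eq_zero_of_integral_contDiff_smul_eq_zero
      (show IntegrableOn z Ω volume from L1.integrable_coeFn z).locallyIntegrableOn
      fun η hη hηc hηs => ?_
    rw [← hz η hη hηc hηs, setIntegral_eq_integral_of_forall_compl_eq_zero]
    · simp_rw [smul_eq_mul, mul_comm]
    · intro x hx
      rw [image_eq_zero_of_notMem_tsupport fun h => hx (hηs h), mul_zero]
  rw [Lp.eq_zero_iff_ae_eq_zero]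
  exact (ae_restrict_iff' hΩ.measurableSet).2 hz0

/-- A function with weak time derivative `d` and initial value `c₀` is `c₀ + ∫₀ᵗ d`. -/
theorem HasWeakTimeDeriv.ae_eq_primitive {Ω : Set E3} (hΩ : IsOpen Ω)
    [IsFiniteMeasure ((volume : Measure E3).restrict Ω)] {T : ℝ} (hT : 0 < T) {c : ℝ → L2 Ω ℝ}
    (hc : Integrable c (volume.restrict (Ioo 0 T))) {c₀ : L2 Ω ℝ}
    {d : ℝ → Lp ℝ 1 (volume.restrict Ω)} (h : HasWeakTimeDeriv Ω T c c₀ d)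
    (hd : Integrable ((Ioo 0 T).indicator d)) :
    ∀ᵐ t ∂(volume.restrict (Ioo 0 T)),
      toL1 (c t) = toL1 c₀ + ∫ s in (0 : ℝ)..t, (Ioo 0 T).indicator d s := by
  have hfI : IntegrableOn (fun t => toL1 (c t)
      - (toL1 c₀ + ∫ s in (0 : ℝ)..t, (Ioo 0 T).indicator d s)) (Ioo 0 T) :=
    (show IntegrableOn (fun t => toL1 (c t)) (Ioo 0 T) from toL1.integrable_comp hc).sub
      (((continuous_primitive_of_integrable hd _).continuousOn.integrableOn_compact
        isCompact_Icc).mono_set Ioo_subset_Icc_self)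
  have := isOpen_Ioo.ae_eq_zero_of_integral_contDiff_smul_eq_zero hfI.locallyIntegrableOn
    fun χ hχ hχc hχs => by
      rw [← h.integral_smul_sub_primitive hΩ hT hc hd hχ hχc hχs,
        setIntegral_eq_integral_of_forall_compl_eq_zero]
      intro t ht
      rw [image_eq_zero_of_notMem_tsupport fun h => ht (hχs h), zero_smul]
  rw [ae_restrict_iff' measurableSet_Ioo]
  filter_upwards [this] with t ht hmem
  exact sub_eq_zero.1 (ht hmem)

/-! ### The maximum principle -/

theorem exists_lipschitzWith_smoothTransition : ∃ K, LipschitzWith K Real.smoothTransition := by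
  have hs : ContDiff ℝ 1 Real.smoothTransition := by
    exact_mod_cast (Real.smoothTransition.contDiff (n := 1))
  obtain ⟨M, hM⟩ := isCompact_Icc.exists_bound_of_continuousOn
    ((hs.continuous_deriv le_rfl).continuousOn (s := Icc (0 : ℝ) 1))
  refine ⟨Real.toNNReal M, lipschitzWith_of_nnnorm_deriv_le (hs.differentiable one_ne_zero)
    fun s => ?_⟩
  have hM0 : 0 ≤ M := (norm_nonneg _).trans (hM 0 ⟨le_rfl, zero_le_one⟩)
  rw [← NNReal.coe_le_coe, coe_nnnorm, Real.coe_toNNReal _ hM0]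
  by_cases h : s ∈ Icc (0 : ℝ) 1
  · exact hM s h
  · refine le_of_eq_of_le ?_ hM0
    rw [norm_eq_zero]
    rcases lt_or_ge s 0 with h0 | h0
    · have : Real.smoothTransition =ᶠ[𝓝 s] fun _ => 0 := by
        filter_upwards [Iio_mem_nhds h0] with r hr
        exact Real.smoothTransition.zero_of_nonpos (le_of_lt hr)
      rw [this.deriv_eq, deriv_const]
    · have h1 : 1 < s := not_le.1 fun h1 => h ⟨h0, h1⟩
      have : Real.smoothTransition =ᶠ[𝓝 s] fun _ => 1 := by
        filter_upwards [Ioi_mem_nhds h1] with r hr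
        exact Real.smoothTransition.one_of_one_le (le_of_lt hr)
      rw [this.deriv_eq, deriv_const]

/-- A smooth monotone function which vanishes exactly on `[f₁, f₂]`. -/
def outward (f₁ f₂ s : ℝ) : ℝ := Real.smoothTransition (s - f₂) - Real.smoothTransition (f₁ - s)

theorem contDiff_outward (f₁ f₂ : ℝ) : ContDiff ℝ 1 (outward f₁ f₂) := by
  have hs : ContDiff ℝ 1 Real.smoothTransition := by
    exact_mod_cast (Real.smoothTransition.contDiff (n := 1))
  exact (hs.comp (contDiff_id.sub contDiff_const)).sub (hs.comp (contDiff_const.sub contDiff_id))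

theorem monotone_outward (f₁ f₂ : ℝ) : Monotone (outward f₁ f₂) := fun r s hrs =>
  sub_le_sub (Real.smoothTransition.monotone (by linarith))
    (Real.smoothTransition.monotone (by linarith))

/-- Boundedness is what allows testing against a time derivative that is only integrable. -/
theorem abs_outward_le (f₁ f₂ s : ℝ) : |outward f₁ f₂ s| ≤ 1 := by
  have h1 := Real.smoothTransition.nonneg (s - f₂)
  have h2 := Real.smoothTransition.nonneg (f₁ - s)
  have h3 := Real.smoothTransition.le_one (s - f₂)
  have h4 := Real.smoothTransition.le_one (f₁ - s)
  rw [outward, abs_le]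
  constructor <;> linarith

theorem exists_lipschitzWith_outward (f₁ f₂ : ℝ) : ∃ K, LipschitzWith K (outward f₁ f₂) := by
  obtain ⟨K, hK⟩ := exists_lipschitzWith_smoothTransition
  refine ⟨K * 1 + K * 1, (hK.comp ?_).sub (hK.comp ?_)⟩
  · exact LipschitzWith.of_dist_le_mul fun x y => by simp
  · exact LipschitzWith.of_dist_le_mul fun x y => by
      simp only [dist_sub_left, NNReal.coe_one, one_mul, le_refl]

theorem outward_eq_zero {f₁ f₂ s : ℝ} (hs : s ∈ Icc f₁ f₂) : outward f₁ f₂ s = 0 := by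
  rw [outward, Real.smoothTransition.zero_of_nonpos (by linarith [hs.2]),
    Real.smoothTransition.zero_of_nonpos (by linarith [hs.1]), sub_zero]

theorem outward_pos {f₁ f₂ s : ℝ} (hf : f₁ ≤ f₂) (hs : f₂ < s) : 0 < outward f₁ f₂ s := by
  rw [outward, Real.smoothTransition.zero_of_nonpos (by linarith : f₁ - s ≤ 0), sub_zero]
  exact Real.smoothTransition.pos_of_pos (by linarith)

theorem outward_neg {f₁ f₂ s : ℝ} (hf : f₁ ≤ f₂) (hs : s < f₁) : outward f₁ f₂ s < 0 := by
  rw [outward, Real.smoothTransition.zero_of_nonpos (by linarith : s - f₂ ≤ 0), zero_sub,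
    neg_lt_zero]
  exact Real.smoothTransition.pos_of_pos (by linarith)

/-- A convex penalty which vanishes exactly on `[f₁, f₂]`. -/
def penalty (f₁ f₂ s : ℝ) : ℝ := ∫ r in f₁..s, outward f₁ f₂ r

theorem hasDerivAt_penalty (f₁ f₂ s : ℝ) : HasDerivAt (penalty f₁ f₂) (outward f₁ f₂ s) s :=
  ((contDiff_outward f₁ f₂).continuous.integral_hasStrictDerivAt f₁ s).hasDerivAt

theorem penalty_eq_zero {f₁ f₂ s : ℝ} (hs : s ∈ Icc f₁ f₂) : penalty f₁ f₂ s = 0 := by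
  refine intervalIntegral.integral_zero_ae (Eventually.of_forall fun r hr => ?_)
  rw [uIoc_of_le hs.1] at hr
  exact outward_eq_zero ⟨hr.1.le, hr.2.trans hs.2⟩

theorem penalty_pos {f₁ f₂ s : ℝ} (hf : f₁ ≤ f₂) (hs : s ∉ Icc f₁ f₂) : 0 < penalty f₁ f₂ s := by
  have hi : ∀ a b, IntervalIntegrable (outward f₁ f₂) volume a b := fun a b =>
    (contDiff_outward f₁ f₂).continuous.intervalIntegrable a b
  rcases lt_or_ge s f₁ with h | h
  · have := intervalIntegral.intervalIntegral_pos_of_pos_on (hi s f₁).neg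
      (fun r hr => neg_pos.2 (outward_neg hf hr.2)) h
    rw [penalty, intervalIntegral.integral_symm, ← intervalIntegral.integral_neg]
    exact this
  · have h2 : f₂ < s := not_le.1 fun h2 => hs ⟨h, h2⟩
    have := intervalIntegral.intervalIntegral_pos_of_pos_on (hi f₂ s)
      (fun r hr => outward_pos hf hr.1) h2
    rw [penalty, ← intervalIntegral.integral_add_adjacent_intervals (hi f₁ f₂) (hi f₂ s)]
    have h0 : ∫ r in f₁..f₂, outward f₁ f₂ r = 0 := penalty_eq_zero (right_mem_Icc.2 hf)
    rwa [h0, zero_add]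

theorem penalty_nonneg {f₁ f₂ : ℝ} (hf : f₁ ≤ f₂) (s : ℝ) : 0 ≤ penalty f₁ f₂ s := by
  by_cases hs : s ∈ Icc f₁ f₂
  · exact (penalty_eq_zero hs).ge
  · exact (penalty_pos hf hs).le

theorem IsPotentialDeriv.outward_mul_nonneg {F : ℝ → ℝ} {f₁ f₂ : ℝ} {dF : ℝ → ℝ}
    (h : IsPotentialDeriv F f₁ f₂ dF) (hf : f₁ ≤ f₂) (s : ℝ) : 0 ≤ outward f₁ f₂ s * dF s := by
  rcases lt_or_ge s f₁ with h1 | h1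
  · exact mul_nonneg_of_nonpos_of_nonpos (outward_neg hf h1).le (h.nonpos s h1)
  rcases lt_or_ge f₂ s with h2 | h2
  · exact mul_nonneg (outward_pos hf h2).le (h.nonneg s h2)
  · rw [outward_eq_zero ⟨h1, h2⟩, zero_mul]

theorem integrable_tr {Ω : Set E3} [IsFiniteMeasure ((volume : Measure E3).restrict Ω)]
    (H : L2 Ω (E3 →L[ℝ] E3)) : Integrable (fun x => tr (H x)) (volume.restrict Ω) :=
  trL.integrable_comp ((Lp.memLp H).integrable one_le_two)

theorem integrable_bounded_mul {α : Type} [MeasurableSpace α] {μ : Measure α} {β : ℝ → ℝ}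
    (hβ : Continuous β) {C : ℝ} (hC : ∀ s, |β s| ≤ C) {p : ℝ≥0∞} (g : Lp ℝ p μ) {f : α → ℝ}
    (hf : Integrable f μ) : Integrable (fun x => β (g x) * f x) μ :=
  hf.bdd_mul (hβ.comp_aestronglyMeasurable (Lp.aestronglyMeasurable g))
    (Eventually.of_forall fun _ => hC _)

/-- The rate of change of the penalty of a solution is nonpositive. -/
theorem integral_outward_mul_le_zero {Ω : Set E3} (hΩ : IsLipschitzDomain Ω) {ε : ℝ} (hε : 0 < ε)
    {F : ℝ → ℝ} {f₁ f₂ : ℝ} (hf : f₁ ≤ f₂) {dF : ℝ → ℝ} (hdF : IsPotentialDeriv F f₁ f₂ dF)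
    {J : Jet2 Ω} (hJ : J ∈ W22n Ω) {v : L2 Ω E3} (hv : v ∈ L2div Ω)
    {d : Lp ℝ 1 (volume.restrict Ω)}
    (h : ∀ᵐ x ∂(volume.restrict Ω), d x + inner ℝ (v x) (J.2.1 x) =
        ε * tr (J.2.2 x) - (1 / ε) * dF (J.1 x)) :
    ∫ x in Ω, outward f₁ f₂ (J.1 x) * d x ≤ 0 := by
  have := hΩ.isFiniteMeasure
  obtain ⟨K, hK⟩ := exists_lipschitzWith_outward f₁ f₂
  have hb := fun {p : ℝ≥0∞} (g : Lp ℝ p (volume.restrict Ω)) {f : E3 → ℝ} =>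
    integrable_bounded_mul (contDiff_outward f₁ f₂).continuous (abs_outward_le f₁ f₂) g (f := f)
  -- Monotonicity permits `m = 0`: diffusion does not increase the penalty.
  have h1 := integral_mul_laplacian_le hΩ (contDiff_outward f₁ f₂) hK (m := 0)
    (fun s => by simpa using (monotone_outward f₁ f₂).deriv_nonneg) hJ
  have h2 := integral_mul_inner_eq_zero hΩ (hasDerivAt_penalty f₁ f₂) hK (abs_outward_le f₁ f₂)
    hJ hv
  have i1 := (hb J.1 (integrable_tr J.2.2)).const_mul ε
  have i2 := hb J.1 (L2.integrable_inner (𝕜 := ℝ) v J.2.1)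
  calc ∫ x in Ω, outward f₁ f₂ (J.1 x) * d x
      ≤ ∫ x in Ω, (ε * (outward f₁ f₂ (J.1 x) * tr (J.2.2 x))
          - outward f₁ f₂ (J.1 x) * inner ℝ (v x) (J.2.1 x)) := by
        -- The reaction term is dropped pointwise by its sign, before the integrals are split:
        -- outside `[f₁, f₂]` nothing is known about the measurability of `dF`.
        refine integral_mono_ae (hb J.1 (L1.integrable_coeFn d)) (i1.sub i2) ?_
        filter_upwards [h] with x hx
        have h3 := mul_nonneg (one_div_pos.2 hε).le (hdF.outward_mul_nonneg hf (J.1 x))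
        have h4 : d x = ε * tr (J.2.2 x) - (1 / ε) * dF (J.1 x) - inner ℝ (v x) (J.2.1 x) := by
          linarith
        rw [h4]
        nlinarith
    _ = ε * ∫ x in Ω, outward f₁ f₂ (J.1 x) * tr (J.2.2 x) := by
        rw [integral_sub i1 i2, h2, sub_zero, integral_const_mul]
    _ ≤ 0 := mul_nonpos_of_nonneg_of_nonpos hε.le (by simpa using h1)

theorem IsConcentration.integrable_fst {Ω : Set E3} {T : ℝ} {c : ℝ → Jet2 Ω}
    (hc : IsConcentration Ω T c) : Integrable (fun t => (c t).1) (volume.restrict (Ioo 0 T)) :=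
  (hc.memLp_two.integrable one_le_two).fst

/-- Solutions starting in `[f₁, f₂]` stay in `[f₁, f₂]`. -/
theorem IsSolution.mem_Icc {Ω : Set E3} (hΩ : IsLipschitzDomain Ω) {T : ℝ} (hT : 0 < T) {ε : ℝ}
    (hε : 0 < ε) {F : ℝ → ℝ} {f₁ f₂ : ℝ} (hf : f₁ ≤ f₂) {dF : ℝ → ℝ}
    (hdF : IsPotentialDeriv F f₁ f₂ dF) {c₀ : L2 Ω ℝ}
    (hc₀ : ∀ᵐ x ∂(volume.restrict Ω), c₀ x ∈ Icc f₁ f₂) {u : ℝ → VJet1 Ω} {c : ℝ → Jet2 Ω}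
    (hu : IsVelocity Ω T u) (hc : IsConcentration Ω T c) (h : IsSolution Ω T ε dF c₀ u c) :
    ∀ᵐ t ∂(volume.restrict (Ioo 0 T)), ∀ᵐ x ∂(volume.restrict Ω), (c t).1 x ∈ Icc f₁ f₂ := by
  have := hΩ.isFiniteMeasure
  obtain ⟨d, hd, hw, hpde⟩ := h
  have hd' : Integrable ((Ioo 0 T).indicator d) :=
    (integrable_indicator_iff measurableSet_Ioo).2 hd
  have hrep := hw.ae_eq_primitive hΩ.isOpen hT hc.integrable_fst hd'
  have key := fun t (ht : t ∈ Icc 0 T) => integral_comp_primitive_le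
    (hasDerivAt_penalty f₁ f₂) (contDiff_outward f₁ f₂).continuous (abs_outward_le f₁ f₂) hd'
    (toL1 c₀) (T := T) (g := fun _ => 0) (by simp) (by
      filter_upwards [hrep, hpde, hu.2, hc.mem_W22n, ae_restrict_mem measurableSet_Ioo]
        with s h1 h2 h3 h4 h5
      rw [← h1, indicator_of_mem h5]
      refine le_of_eq_of_le ?_ (integral_outward_mul_le_zero hΩ hε hf hdF h4 h3.2 h2)
      refine integral_congr_ae ?_
      filter_upwards [coeFn_toL1 (c s).1] with x hx
      rw [hx]) ht
  have h0 : ∫ x in Ω, penalty f₁ f₂ (toL1 c₀ x) = 0 := by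
    refine integral_eq_zero_of_ae ?_
    filter_upwards [coeFn_toL1 c₀, hc₀] with x h1 h2
    rw [h1]
    exact penalty_eq_zero h2
  filter_upwards [hrep, ae_restrict_mem measurableSet_Ioo] with t h1 h2
  have h3 := key t (Ioo_subset_Icc_self h2)
  rw [← h1, h0, intervalIntegral.integral_zero, add_zero] at h3
  have h4 := (integral_eq_zero_iff_of_nonneg (fun x => penalty_nonneg hf _)
    (integrable_comp_of_hasDerivAt (hasDerivAt_penalty f₁ f₂) (abs_outward_le f₁ f₂)
      (L1.integrable_coeFn (toL1 (c t).1)))).1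
    (le_antisymm h3 (integral_nonneg fun x => penalty_nonneg hf _))
  filter_upwards [h4, coeFn_toL1 (c t).1] with x k1 k2
  rw [k2] at k1
  by_contra hx
  exact (penalty_pos hf hx).ne' k1

/-! ### Stability of solutions -/

/-- A truncation of `s ↦ s²`. -/
theorem exists_truncated_sq {R : ℝ} (hR : 0 ≤ R) :
    ∃ (B β : ℝ → ℝ) (K : ℝ≥0) (C : ℝ), (∀ s, HasDerivAt B (β s) s) ∧ ContDiff ℝ 1 β ∧
      LipschitzWith K β ∧ (∀ s, |β s| ≤ C) ∧ ∀ s, |s| ≤ R → B s = s ^ 2 ∧ β s = 2 * s := by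
  -- The inner radius `R + 1` makes the truncation equal to `s²` in a neighbourhood of every `|s| ≤
  -- R`, so the derivatives agree there too.
  let φ : ContDiffBump (0 : ℝ) := ⟨R + 1, R + 2, by linarith, by linarith⟩
  have hB : ContDiff ℝ ∞ fun s => s ^ 2 * φ s := (contDiff_id.pow 2).mul φ.contDiff
  have hβ : ContDiff ℝ 1 (deriv fun s => s ^ 2 * φ s) :=
    (contDiff_infty_iff_deriv.1 hB).2.of_le (by exact_mod_cast le_top)
  have hc : HasCompactSupport (deriv fun s => s ^ 2 * φ s) :=
    (φ.hasCompactSupport.mul_left (f := fun s : ℝ => s ^ 2)).deriv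
  obtain ⟨K, hK⟩ := hβ.lipschitzWith_of_hasCompactSupport hc one_ne_zero
  obtain ⟨C, hC⟩ := hc.exists_bound_of_continuous hβ.continuous
  have h1 : ∀ s : ℝ, |s| ≤ R + 1 → φ s = 1 := fun s hs =>
    φ.one_of_mem_closedBall (by simpa [Real.norm_eq_abs] using hs)
  refine ⟨_, _, K, C, fun s => (hB.differentiable (by simp) s).hasDerivAt, hβ, hK, hC,
    fun s hs => ⟨by simp [h1 s (by linarith)], ?_⟩⟩
  have : (fun s => s ^ 2 * φ s) =ᶠ[𝓝 s] fun s => s ^ 2 := by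
    filter_upwards [continuous_abs.continuousAt.eventually_lt continuousAt_const
      (show |s| < R + 1 by linarith)] with r hr
    rw [h1 r hr.le, mul_one]
  rw [this.deriv_eq]
  simp

/-- The truncated `β` is not monotone, so diffusion loses its sign; the loss `K ∫ |∇w|²` is harmless
because the estimate allows this term on its right side. -/
theorem neg_le_deriv_of_lipschitzWith {β : ℝ → ℝ} {K : ℝ≥0} (hK : LipschitzWith K β) (s : ℝ) :
    -(K : ℝ) ≤ deriv β s :=
  (abs_le.1 (norm_deriv_le_of_lipschitz hK)).1

/-- With `w = c₁ - c₂`, `v = v₁ - v₂`, `g = g₁ - g₂`, the convective part is `-2w v₁·g - 2w v·g₂`,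
and `-2w v·g₂ = -2c₁ v·g₁ + 2w v·g + 2c₂ v·g₂ + 2c₂ v·g`. Apart from the last term, everything has
the form `2s v·∇s` with one and the same `s`, hence integrates to zero for solenoidal fields. The
last term is bounded by `|c₂| ≤ R` and Young's inequality, so no bound on the gradients or
velocities is required. -/
theorem two_mul_sub_mul_le {ε : ℝ} (hε : 0 < ε) {R L : ℝ} (hR : 0 ≤ R) {c₁ c₂ a₁ a₂ p₁ p₂ d₁ d₂ : ℝ}
    {g₁ g₂ v₁ v₂ : E3} (hc : |c₂| ≤ R) (hp : |p₁ - p₂| ≤ L * |c₁ - c₂|)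
    (h₁ : d₁ + inner ℝ v₁ g₁ = ε * a₁ - (1 / ε) * p₁)
    (h₂ : d₂ + inner ℝ v₂ g₂ = ε * a₂ - (1 / ε) * p₂) :
    2 * (c₁ - c₂) * (d₁ - d₂) ≤ ε * (2 * (c₁ - c₂) * (a₁ - a₂)) + 2 * L / ε * (c₁ - c₂) ^ 2
      + R * (‖g₁ - g₂‖ ^ 2 + ‖v₁ - v₂‖ ^ 2) - 2 * (c₁ - c₂) * inner ℝ v₁ (g₁ - g₂)
      - 2 * c₁ * inner ℝ (v₁ - v₂) g₁ + 2 * (c₁ - c₂) * inner ℝ (v₁ - v₂) (g₁ - g₂)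
      + 2 * c₂ * inner ℝ (v₁ - v₂) g₂ := by
  have hpot : -(2 * (c₁ - c₂) * ((1 / ε) * (p₁ - p₂))) ≤ 2 * L / ε * (c₁ - c₂) ^ 2 := by
    have q1 : -((c₁ - c₂) * (p₁ - p₂)) ≤ L * (c₁ - c₂) ^ 2 := by
      refine (neg_le_abs _).trans ?_
      rw [abs_mul]
      calc |c₁ - c₂| * |p₁ - p₂| ≤ |c₁ - c₂| * (L * |c₁ - c₂|) :=
            mul_le_mul_of_nonneg_left hp (abs_nonneg _)
        _ = L * (c₁ - c₂) ^ 2 := by rw [← sq_abs]; ring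
    calc _ = 2 / ε * -((c₁ - c₂) * (p₁ - p₂)) := by ring
      _ ≤ 2 / ε * (L * (c₁ - c₂) ^ 2) := mul_le_mul_of_nonneg_left q1 (by positivity)
      _ = _ := by ring
  have hconv : 2 * (c₂ * inner ℝ (v₁ - v₂) (g₁ - g₂)) ≤ R * (‖g₁ - g₂‖ ^ 2 + ‖v₁ - v₂‖ ^ 2) := by
    have q1 : |c₂ * inner ℝ (v₁ - v₂) (g₁ - g₂)| ≤ R * (‖v₁ - v₂‖ * ‖g₁ - g₂‖) := by
      rw [abs_mul]
      exact mul_le_mul hc (abs_real_inner_le_norm _ _) (abs_nonneg _) hR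
    have q2 := le_abs_self (c₂ * inner ℝ (v₁ - v₂) (g₁ - g₂))
    have q3 := mul_le_mul_of_nonneg_left (two_mul_le_add_sq ‖v₁ - v₂‖ ‖g₁ - g₂‖) hR
    linarith
  rw [eq_sub_of_add_eq h₁, eq_sub_of_add_eq h₂]
  simp only [inner_sub_left, inner_sub_right] at hconv ⊢
  linarith

set_option maxHeartbeats 800000 in
/-- The rate of change of the squared distance of two bounded solutions. -/
theorem integral_mul_sub_le {Ω : Set E3} (hΩ : IsLipschitzDomain Ω) {ε : ℝ} (hε : 0 < ε)
    {B β : ℝ → ℝ} (hB : ∀ s, HasDerivAt B (β s) s) (hβ : ContDiff ℝ 1 β) {K : ℝ≥0}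
    (hK : LipschitzWith K β) {C R L : ℝ} (hC : ∀ s, |β s| ≤ C)
    (hβR : ∀ s, |s| ≤ 2 * R → β s = 2 * s) {dF : ℝ → ℝ} {J₁ J₂ : Jet2 Ω} (hJ₁ : J₁ ∈ W22n Ω)
    (hJ₂ : J₂ ∈ W22n Ω) (hR₁ : ∀ᵐ x ∂(volume.restrict Ω), |J₁.1 x| ≤ R)
    (hR₂ : ∀ᵐ x ∂(volume.restrict Ω), |J₂.1 x| ≤ R)
    (hL : ∀ᵐ x ∂(volume.restrict Ω), |dF (J₁.1 x) - dF (J₂.1 x)| ≤ L * |J₁.1 x - J₂.1 x|)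
    {v₁ v₂ : L2 Ω E3} (hv₁ : v₁ ∈ L2div Ω) (hv₂ : v₂ ∈ L2div Ω)
    {d₁ d₂ : Lp ℝ 1 (volume.restrict Ω)}
    (h₁ : ∀ᵐ x ∂(volume.restrict Ω), d₁ x + inner ℝ (v₁ x) (J₁.2.1 x) =
        ε * tr (J₁.2.2 x) - (1 / ε) * dF (J₁.1 x))
    (h₂ : ∀ᵐ x ∂(volume.restrict Ω), d₂ x + inner ℝ (v₂ x) (J₂.2.1 x) =
        ε * tr (J₂.2.2 x) - (1 / ε) * dF (J₂.1 x)) :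
    ∫ x in Ω, β ((J₁ - J₂).1 x) * (d₁ - d₂ : Lp ℝ 1 (volume.restrict Ω)) x
      ≤ 2 * L / ε * (∫ x in Ω, (J₁ - J₂).1 x ^ 2)
        + (ε * K + R) * (‖(J₁ - J₂).2.1‖ ^ 2 + ‖v₁ - v₂‖ ^ 2) := by
  have := hΩ.isFiniteMeasure
  have hR : 0 ≤ R := by
    -- A nonempty open set has positive measure, so the a.e. bound holds at some point and forces `R
    -- ≥ 0`.
    have hne : (volume.restrict Ω : Measure E3) ≠ 0 := by
      rw [Ne, Measure.restrict_eq_zero]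
      exact (hΩ.isOpen.measure_pos volume hΩ.isConnected.nonempty).ne'
    have : (ae (volume.restrict Ω : Measure E3)).NeBot := ae_neBot.2 hne
    obtain ⟨x, hx⟩ := hR₁.exists
    exact (abs_nonneg _).trans hx
  have hwW := sub_mem_W22n hJ₁ hJ₂
  have hvW := sub_mem_L2div hv₁ hv₂
  have e1 : (J₁ - J₂).1 =ᵐ[volume.restrict Ω] fun x => J₁.1 x - J₂.1 x :=
    Lp.coeFn_sub J₁.1 J₂.1
  have e2 : (J₁ - J₂).2.1 =ᵐ[volume.restrict Ω] fun x => J₁.2.1 x - J₂.2.1 x :=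
    Lp.coeFn_sub J₁.2.1 J₂.2.1
  have e3 : (J₁ - J₂).2.2 =ᵐ[volume.restrict Ω] fun x => J₁.2.2 x - J₂.2.2 x :=
    Lp.coeFn_sub J₁.2.2 J₂.2.2
  have e4 : (v₁ - v₂ : L2 Ω E3) =ᵐ[volume.restrict Ω] fun x => v₁ x - v₂ x :=
    Lp.coeFn_sub v₁ v₂
  have e5 : (d₁ - d₂ : Lp ℝ 1 (volume.restrict Ω)) =ᵐ[volume.restrict Ω] fun x => d₁ x - d₂ x :=
    Lp.coeFn_sub d₁ d₂
  generalize J₁ - J₂ = w at *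
  generalize v₁ - v₂ = v at *
  generalize d₁ - d₂ = D at *
  have hb := fun {p : ℝ≥0∞} (g : Lp ℝ p (volume.restrict Ω)) {f : E3 → ℝ} =>
    integrable_bounded_mul hβ.continuous hC g (f := f)
  have ht := fun {J : Jet2 Ω} (hJ : J ∈ W22n Ω) {v : L2 Ω E3} (hv : v ∈ L2div Ω) =>
    integral_mul_inner_eq_zero hΩ hB hK hC hJ hv
  have hlap := integral_mul_laplacian_le hΩ hβ hK (neg_le_deriv_of_lipschitzWith hK) hwW
  have i1 := (hb w.1 (integrable_tr w.2.2)).const_mul ε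
  have i2 : Integrable (fun x => 2 * L / ε * w.1 x ^ 2) (volume.restrict Ω) :=
    (Lp.memLp w.1).integrable_sq.const_mul _
  have i3 := ((integrable_norm_sq w.2.1).add (integrable_norm_sq v)).const_mul R
  have i4 := hb w.1 (L2.integrable_inner (𝕜 := ℝ) v₁ w.2.1)
  have i5 := hb J₁.1 (L2.integrable_inner (𝕜 := ℝ) v J₁.2.1)
  have i6 := hb w.1 (L2.integrable_inner (𝕜 := ℝ) v w.2.1)
  have i7 := hb J₂.1 (L2.integrable_inner (𝕜 := ℝ) v J₂.2.1)
  have j3 := (i1.add i2).add i3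
  have j4 := j3.sub i4
  have j5 := j4.sub i5
  have j6 := j5.add i6
  have hint := integral_add' j6 i7
  -- The four transport integrals vanish, for `w` with `v₁`, and for `c₁`, `w`, `c₂` with `v₁ - v₂`.
  rw [integral_add' j5 i6, integral_sub' j4 i5, integral_sub' j3 i4, integral_add' (i1.add i2) i3,
    integral_add' i1 i2, ht hwW hv₁, ht hJ₁ hvW, ht hwW hvW, ht hJ₂ hvW, integral_const_mul,
    integral_const_mul, integral_const_mul] at hint
  have hsum : ∫ x in Ω, ((fun x => ‖w.2.1 x‖ ^ 2) + fun x => ‖v x‖ ^ 2) x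
      = ‖w.2.1‖ ^ 2 + ‖v‖ ^ 2 := by
    rw [integral_add' (integrable_norm_sq w.2.1) (integrable_norm_sq v), integral_norm_sq_eq,
      integral_norm_sq_eq]
  rw [hsum] at hint
  rw [integral_norm_sq_eq] at hlap
  refine (integral_mono_ae (hb w.1 (L1.integrable_coeFn D)) (j6.add i7) ?_).trans ?_
  · filter_upwards [hR₁, hR₂, hL, h₁, h₂, e1, e2, e3, e4, e5]
      with x k1 k2 k3 k4 k5 e1 e2 e3 e4 e5
    have e3' : tr (w.2.2 x) = tr (J₁.2.2 x) - tr (J₂.2.2 x) := by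
      rw [e3]
      exact map_sub trL _ _
    have hwR : |J₁.1 x - J₂.1 x| ≤ 2 * R := by
      linarith [abs_sub (J₁.1 x) (J₂.1 x)]
    simp only [Pi.add_apply, Pi.sub_apply]
    rw [e1, e2, e3', e4, e5, hβR _ hwR, hβR (J₁.1 x) (by linarith),
      hβR (J₂.1 x) (by linarith)]
    exact two_mul_sub_mul_le hε hR k2 k3 k4 k5
  · rw [hint]
    have := mul_le_mul_of_nonneg_left hlap hε.le
    have hv0 : 0 ≤ ε * K * ‖v‖ ^ 2 := by positivity
    linarith

theorem integral_norm_sub_sq_eq {Ω : Set E3} {V : Type} [NormedAddCommGroup V]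
    [InnerProductSpace ℝ V] (f g : L2 Ω V) : ∫ x in Ω, ‖f x - g x‖ ^ 2 = ‖f - g‖ ^ 2 := by
  rw [← integral_norm_sq_eq]
  refine integral_congr_ae ?_
  filter_upwards [Lp.coeFn_sub f g] with x hx
  rw [hx, Pi.sub_apply]

theorem integrable_norm_sub_sq {Ω : Set E3} {V : Type} [NormedAddCommGroup V]
    (f g : L2 Ω V) : Integrable (fun x => ‖f x - g x‖ ^ 2) (volume.restrict Ω) := by
  refine (integrable_norm_sq (f - g)).congr ?_
  filter_upwards [Lp.coeFn_sub f g] with x hx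
  rw [hx, Pi.sub_apply]

theorem intervalIntegrable_norm_sq {X : Type} [NormedAddCommGroup X] {f : ℝ → X} {T : ℝ}
    (hT : 0 ≤ T) (hf : MemLp f 2 (volume.restrict (Ioo 0 T))) :
    IntervalIntegrable (fun t => ‖f t‖ ^ 2) volume 0 T :=
  (intervalIntegrable_iff_integrableOn_Ioo_of_le hT).2 (hf.integrable_norm_pow two_ne_zero)

/-- Stability of bounded solutions with respect to the velocity. -/
theorem integral_sub_sq_le {Ω : Set E3} (hΩ : IsLipschitzDomain Ω) {T : ℝ} (hT : 0 < T) {ε : ℝ}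
    (hε : 0 < ε) {B β : ℝ → ℝ} (hB : ∀ s, HasDerivAt B (β s) s) (hβ : ContDiff ℝ 1 β) {K : ℝ≥0}
    (hK : LipschitzWith K β) {C R : ℝ} (hC : ∀ s, |β s| ≤ C) (hR : 0 ≤ R)
    (hBR : ∀ s, |s| ≤ 2 * R → B s = s ^ 2 ∧ β s = 2 * s) {f₁ f₂ : ℝ}
    (hRf : ∀ s ∈ Icc f₁ f₂, |s| ≤ R) {dF : ℝ → ℝ} {L : ℝ≥0}
    (hL : LipschitzOnWith L dF (Icc f₁ f₂)) {c₀ : L2 Ω ℝ} {u₁ u₂ : ℝ → VJet1 Ω}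
    {c₁ c₂ : ℝ → Jet2 Ω} (hu₁ : IsVelocity Ω T u₁) (hu₂ : IsVelocity Ω T u₂)
    (hc₁ : IsConcentration Ω T c₁) (hc₂ : IsConcentration Ω T c₂)
    (h₁ : IsSolution Ω T ε dF c₀ u₁ c₁) (h₂ : IsSolution Ω T ε dF c₀ u₂ c₂)
    (hb₁ : ∀ᵐ t ∂(volume.restrict (Ioo 0 T)), ∀ᵐ x ∂(volume.restrict Ω), (c₁ t).1 x ∈ Icc f₁ f₂)
    (hb₂ : ∀ᵐ t ∂(volume.restrict (Ioo 0 T)), ∀ᵐ x ∂(volume.restrict Ω), (c₂ t).1 x ∈ Icc f₁ f₂) :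
    ∀ᵐ t ∂(volume.restrict (Ioo 0 T)),
      ∫ x in Ω, ((c₁ t).1 x - (c₂ t).1 x) ^ 2 ≤
        (ε * K + R) * Real.exp (2 * L / ε * T) * ∫ s in (0 : ℝ)..t,
          (‖(c₁ s - c₂ s).2.1‖ ^ 2 + ‖(u₁ s).1 - (u₂ s).1‖ ^ 2) := by
  have := hΩ.isFiniteMeasure
  obtain ⟨d₁, hd₁, hw₁, hpde₁⟩ := h₁
  obtain ⟨d₂, hd₂, hw₂, hpde₂⟩ := h₂
  have hd₁' : Integrable ((Ioo 0 T).indicator d₁) :=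
    (integrable_indicator_iff measurableSet_Ioo).2 hd₁
  have hd₂' : Integrable ((Ioo 0 T).indicator d₂) :=
    (integrable_indicator_iff measurableSet_Ioo).2 hd₂
  set d : ℝ → Lp ℝ 1 (volume.restrict Ω) :=
    fun t => (Ioo 0 T).indicator d₁ t - (Ioo 0 T).indicator d₂ t with hd_def
  have hd : Integrable d := hd₁'.sub hd₂'
  -- The initial data cancel, so the difference is the primitive of `d` starting from `0`.
  have hrep : ∀ᵐ t ∂(volume.restrict (Ioo 0 T)),
      ((0 + ∫ s in (0 : ℝ)..t, d s : Lp ℝ 1 (volume.restrict Ω)) : E3 → ℝ)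
        =ᵐ[volume.restrict Ω] fun x => (c₁ t).1 x - (c₂ t).1 x := by
    filter_upwards [hw₁.ae_eq_primitive hΩ.isOpen hT hc₁.integrable_fst hd₁',
      hw₂.ae_eq_primitive hΩ.isOpen hT hc₂.integrable_fst hd₂'] with t k1 k2
    have e : 0 + ∫ s in (0 : ℝ)..t, d s = toL1 (c₁ t).1 - toL1 (c₂ t).1 := by
      rw [k1, k2, zero_add, add_sub_add_left_eq_sub,
        ← intervalIntegral.integral_sub hd₁'.intervalIntegrable hd₂'.intervalIntegrable]
    rw [e]
    filter_upwards [Lp.coeFn_sub (toL1 (c₁ t).1) (toL1 (c₂ t).1), coeFn_toL1 (c₁ t).1,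
      coeFn_toL1 (c₂ t).1] with x e1 e2 e3
    rw [e1, Pi.sub_apply, e2, e3]
  have hsq : ∀ᵐ t ∂(volume.restrict (Ioo 0 T)),
      ∫ x in Ω, B ((0 + ∫ s in (0 : ℝ)..t, d s : Lp ℝ 1 (volume.restrict Ω)) x)
        = ∫ x in Ω, ((c₁ t).1 x - (c₂ t).1 x) ^ 2 := by
    filter_upwards [hrep, hb₁, hb₂] with t k1 k2 k3
    refine integral_congr_ae ?_
    filter_upwards [k1, k2, k3] with x e1 e2 e3
    rw [e1]
    refine (hBR _ ?_).1
    linarith [abs_sub ((c₁ t).1 x) ((c₂ t).1 x), hRf _ e2, hRf _ e3]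
  set y : ℝ → ℝ := fun t =>
    ∫ x in Ω, B ((0 + ∫ s in (0 : ℝ)..t, d s : Lp ℝ 1 (volume.restrict Ω)) x) with hy
  set g : ℝ → ℝ := fun s => ‖(c₁ s - c₂ s).2.1‖ ^ 2 + ‖(u₁ s).1 - (u₂ s).1‖ ^ 2 with hg
  have hyc : Continuous y := continuous_integral_comp_primitive hB hC hd 0
  have hgI : IntervalIntegrable g volume 0 T := by
    refine (intervalIntegrable_norm_sq hT.le ?_).add (intervalIntegrable_norm_sq hT.le ?_)
    · exact ((ContinuousLinearMap.fst ℝ _ _).comp (ContinuousLinearMap.snd ℝ (L2 Ω ℝ)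
        (L2 Ω E3 × L2 Ω (E3 →L[ℝ] E3)))).comp_memLp' (hc₁.memLp_two.sub hc₂.memLp_two)
    · exact (ContinuousLinearMap.fst ℝ (L2 Ω E3) (L2 Ω (E3 →L[ℝ] E3))).comp_memLp'
        (hu₁.1.sub hu₂.1)
  have hA : 0 ≤ ε * K + R := by positivity
  have ha : 0 ≤ 2 * (L : ℝ) / ε := by positivity
  have hrate : ∀ᵐ t ∂(volume.restrict (Ioo 0 T)),
      ∫ x in Ω, β ((0 + ∫ s in (0 : ℝ)..t, d s : Lp ℝ 1 (volume.restrict Ω)) x) * d t x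
        ≤ 2 * L / ε * y t + (ε * K + R) * g t := by
    filter_upwards [hrep, hsq, hb₁, hb₂, hpde₁, hpde₂, hu₁.2, hu₂.2, hc₁.mem_W22n, hc₂.mem_W22n,
      ae_restrict_mem measurableSet_Ioo] with t k1 k2 k3 k4 k5 k6 k7 k8 k9 k10 k11
    have hest := integral_mul_sub_le hΩ hε hB hβ hK hC (fun s hs => (hBR s hs).2) k9 k10
      (k3.mono fun x hx => hRf _ hx) (k4.mono fun x hx => hRf _ hx) (L := L)
      (by filter_upwards [k3, k4] with x e1 e2 using hL.dist_le_mul _ e1 _ e2)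
      k7.2 k8.2 k5 k6
    have e1 : ((c₁ t - c₂ t).1 : E3 → ℝ) =ᵐ[volume.restrict Ω]
        fun x => (c₁ t).1 x - (c₂ t).1 x := Lp.coeFn_sub (c₁ t).1 (c₂ t).1
    have e2 : ∫ x in Ω, (c₁ t - c₂ t).1 x ^ 2 = y t := by
      rw [hy]
      simp only
      rw [k2]
      refine integral_congr_ae ?_
      filter_upwards [e1] with x hx
      rw [hx]
    have e3 : d t = d₁ t - d₂ t := by
      rw [hd_def]
      simp only [indicator_of_mem k11]
    rw [e2] at hest
    refine le_of_eq_of_le ?_ hest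
    rw [e3]
    refine integral_congr_ae ?_
    filter_upwards [k1, e1] with x m1 m2
    rw [m1, m2]
  have hy0 : ∫ x in Ω, B ((0 : Lp ℝ 1 (volume.restrict Ω)) x) = 0 := by
    refine integral_eq_zero_of_ae ?_
    filter_upwards [Lp.coeFn_zero ℝ 1 (volume.restrict Ω)] with x hx
    rw [hx, Pi.zero_apply, (hBR 0 (by simpa using hR)).1]
    simp
  have hrhs : IntervalIntegrable (fun t => 2 * L / ε * y t + (ε * K + R) * g t) volume 0 T :=
    ((hyc.intervalIntegrable 0 T).const_mul _).add (hgI.const_mul _)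
  have hgron := fun t (ht : t ∈ Icc 0 T) => le_mul_exp_of_le_integral hyc hgI
    (fun s => by positivity) ha hA (fun t ht => by
      have := integral_comp_primitive_le hB hβ.continuous hC hd 0 hrhs hrate ht
      refine this.trans_eq ?_
      rw [hy0, zero_add]) ht
  filter_upwards [hsq, ae_restrict_mem measurableSet_Ioo] with t k1 k2
  rw [← k1]
  exact hgron t (Ioo_subset_Icc_self k2)

end AllenCahn

end

/-! ### The stability estimate and uniqueness under vanishing relative entropy -/

theorem lemmaL (Ω : Set AllenCahn.E3) (hΩ : AllenCahn.IsLipschitzDomain Ω)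
    (T : ℝ) (hT : 0 < T) (ε : ℝ) (hε : 0 < ε)
    (F : ℝ → ℝ) (f₁ y₁ y₂ f₂ : ℝ) (hF : AllenCahn.IsDoubleWell F f₁ y₁ y₂ f₂)
    (dF : ℝ → ℝ) (hdF : AllenCahn.IsPotentialDeriv F f₁ f₂ dF)
    (c₀ : AllenCahn.L2 Ω ℝ) (hc₀ : ∀ᵐ x ∂(volume.restrict Ω), c₀ x ∈ Icc f₁ f₂) :
    (∃ K : ℝ, ∀ (u₁ u₂ : ℝ → AllenCahn.VJet1 Ω) (c₁ c₂ : ℝ → AllenCahn.Jet2 Ω),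
      AllenCahn.IsVelocity Ω T u₁ → AllenCahn.IsVelocity Ω T u₂ →
      AllenCahn.IsConcentration Ω T c₁ → AllenCahn.IsConcentration Ω T c₂ →
      AllenCahn.IsSolution Ω T ε dF c₀ u₁ c₁ → AllenCahn.IsSolution Ω T ε dF c₀ u₂ c₂ →
      ∀ᵐ t ∂(volume.restrict (Icc 0 T)),
        ∫ x in Ω, ((c₁ t).1 x - (c₂ t).1 x) ^ 2 ≤
          K * ∫ s in (0 : ℝ)..t, ∫ x in Ω,
            (‖(c₁ s).2.1 x - (c₂ s).2.1 x‖ ^ 2 + ‖(u₁ s).1 x - (u₂ s).1 x‖ ^ 2)) ∧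
    (∀ (u U : ℝ → AllenCahn.VJet1 Ω) (c C : ℝ → AllenCahn.Jet2 Ω),
      AllenCahn.IsVelocity Ω T u → AllenCahn.IsVelocity Ω T U →
      AllenCahn.IsConcentration Ω T c → AllenCahn.IsConcentration Ω T C →
      AllenCahn.IsSolution Ω T ε dF c₀ u c → AllenCahn.IsSolution Ω T ε dF c₀ U C →
      (∀ᵐ t ∂(volume.restrict (Icc 0 T)),
        AllenCahn.relativeEntropy Ω ε (u t) (c t) (U t) (C t) = 0) →
      ∀ᵐ t ∂(volume.restrict (Icc 0 T)), ∀ᵐ x ∂(volume.restrict Ω),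
        (c t).1 x = (C t).1 x) := by
  have hf : f₁ ≤ f₂ := by linarith [hF.lt₁, hF.lt₂, hF.lt₃]
  have hres : (volume.restrict (Icc 0 T) : Measure ℝ) = volume.restrict (Ioo 0 T) :=
    (Measure.restrict_congr_set Ioo_ae_eq_Icc).symm
  have hG : ∀ (v w : AllenCahn.VJet1 Ω) (J J' : AllenCahn.Jet2 Ω) (a b : ℝ),
      ∫ x in Ω, (a * ‖J.2.1 x - J'.2.1 x‖ ^ 2 + b * ‖v.1 x - w.1 x‖ ^ 2)
        = a * ‖(J - J').2.1‖ ^ 2 + b * ‖v.1 - w.1‖ ^ 2 := fun v w J J' a b => by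
    rw [integral_add ((AllenCahn.integrable_norm_sub_sq _ _).const_mul a)
      ((AllenCahn.integrable_norm_sub_sq _ _).const_mul b), integral_const_mul,
      integral_const_mul, AllenCahn.integral_norm_sub_sq_eq, AllenCahn.integral_norm_sub_sq_eq]
    rfl
  have hstab : ∃ K : ℝ, ∀ (u₁ u₂ : ℝ → AllenCahn.VJet1 Ω) (c₁ c₂ : ℝ → AllenCahn.Jet2 Ω),
      AllenCahn.IsVelocity Ω T u₁ → AllenCahn.IsVelocity Ω T u₂ →
      AllenCahn.IsConcentration Ω T c₁ → AllenCahn.IsConcentration Ω T c₂ →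
      AllenCahn.IsSolution Ω T ε dF c₀ u₁ c₁ → AllenCahn.IsSolution Ω T ε dF c₀ u₂ c₂ →
      ∀ᵐ t ∂(volume.restrict (Icc 0 T)),
        ∫ x in Ω, ((c₁ t).1 x - (c₂ t).1 x) ^ 2 ≤
          K * ∫ s in (0 : ℝ)..t, (‖(c₁ s - c₂ s).2.1‖ ^ 2 + ‖(u₁ s).1 - (u₂ s).1‖ ^ 2) := by
    set R := max |f₁| |f₂|
    have hR : 0 ≤ R := (abs_nonneg f₁).trans (le_max_left _ _)
    have hRf : ∀ s ∈ Icc f₁ f₂, |s| ≤ R := fun s hs => abs_le_max_abs_abs hs.1 hs.2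
    obtain ⟨L, hL⟩ := hF.lipschitz_deriv
    have hL' : LipschitzOnWith L dF (Icc f₁ f₂) := fun x hx y hy => by
      rw [hdF.eq_deriv x hx, hdF.eq_deriv y hy]
      exact hL hx hy
    -- The truncation must be exact up to `2R`, since the difference of two functions bounded by `R`
    -- reaches that size. It depends only on `f₁`, `f₂`, so the final constant does not depend on
    -- the velocities or the solutions.
    obtain ⟨B, β, K, C, hB, hβ, hK, hC, hBR⟩ :=
      AllenCahn.exists_truncated_sq (mul_nonneg zero_le_two hR)
    refine ⟨(ε * K + R) * Real.exp (2 * L / ε * T),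
      fun u₁ u₂ c₁ c₂ hu₁ hu₂ hc₁ hc₂ h₁ h₂ => ?_⟩
    rw [hres]
    exact AllenCahn.integral_sub_sq_le hΩ hT hε hB hβ hK hC hR hBR hRf hL' hu₁ hu₂ hc₁ hc₂ h₁ h₂
      (h₁.mem_Icc hΩ hT hε hf hdF hc₀ hu₁ hc₁) (h₂.mem_Icc hΩ hT hε hf hdF hc₀ hu₂ hc₂)
  obtain ⟨K, hK⟩ := hstab
  refine ⟨⟨K, fun u₁ u₂ c₁ c₂ hu₁ hu₂ hc₁ hc₂ h₁ h₂ => ?_⟩,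
    fun u U c C hu hU hc hC h H hE => ?_⟩
  · filter_upwards [hK u₁ u₂ c₁ c₂ hu₁ hu₂ hc₁ hc₂ h₁ h₂] with t ht
    have e : ∀ s, ∫ x in Ω, (‖(c₁ s).2.1 x - (c₂ s).2.1 x‖ ^ 2 + ‖(u₁ s).1 x - (u₂ s).1 x‖ ^ 2)
        = ‖(c₁ s - c₂ s).2.1‖ ^ 2 + ‖(u₁ s).1 - (u₂ s).1‖ ^ 2 := fun s => by
      simpa using hG (u₁ s) (u₂ s) (c₁ s) (c₂ s) 1 1
    simp_rw [e]
    exact ht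
  · have hzero : ∀ᵐ s ∂(volume.restrict (Icc 0 T)),
        ‖(c s - C s).2.1‖ ^ 2 + ‖(u s).1 - (U s).1‖ ^ 2 = 0 := by
      filter_upwards [hE] with s hs
      -- The weights `ε/2` and `1/2` are positive, so zero relative entropy annihilates both
      -- squares.
      have e := hG (u s) (U s) (c s) (C s) (ε / 2) (1 / 2)
      simp only [AllenCahn.relativeEntropy, add_comm ((1 / 2 : ℝ) * _)] at hs
      rw [hs] at e
      have p1 : 0 ≤ ‖(c s - C s).2.1‖ ^ 2 := sq_nonneg _
      have p2 : 0 ≤ ‖(u s).1 - (U s).1‖ ^ 2 := sq_nonneg _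
      have p3 := mul_nonneg (half_pos hε).le p1
      have p4 : ε / 2 * ‖(c s - C s).2.1‖ ^ 2 = 0 := by linarith
      have p5 := (mul_eq_zero.1 p4).resolve_left (half_pos hε).ne'
      linarith
    filter_upwards [hK u U c C hu hU hc hC h H, ae_restrict_mem measurableSet_Icc] with t ht hmem
    have hint : ∫ s in (0 : ℝ)..t, (‖(c s - C s).2.1‖ ^ 2 + ‖(u s).1 - (U s).1‖ ^ 2) = 0 := by
      refine intervalIntegral.integral_zero_ae ?_
      filter_upwards [(ae_restrict_iff' measurableSet_Icc).1 hzero] with s hs hst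
      rw [uIoc_of_le hmem.1] at hst
      exact hs ⟨hst.1.le, hst.2.trans hmem.2⟩
    rw [hint, mul_zero] at ht
    have hsq : Integrable (fun x => ((c t).1 x - (C t).1 x) ^ 2) (volume.restrict Ω) := by
      simpa using AllenCahn.integrable_norm_sub_sq (c t).1 (C t).1
    have h0 := (integral_eq_zero_iff_of_nonneg (fun x => sq_nonneg _) hsq).1
      (le_antisymm ht (integral_nonneg fun x => sq_nonneg _))
    filter_upwards [h0] with x hx
    exact sub_eq_zero.1 (pow_eq_zero_iff two_ne_zero |>.1 hx)
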